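/- Let $n\ge 1$ be an integer and $0<\alpha<n$. For measurable $f,g:\mathbb R^n\to\mathbb C$ put $$BI_\alpha(f,g)(x)=\int_{\mathbb R^n}\frac{f(x-y)\,g(x+y)}{|y|^{n-\alpha}}\,dy$$ and, for $1\le r,s<\infty$, $$\mathcal M_\alpha^{r,s}(f,g)(x)=\sup_{Q\ni x}|Q|^{\frac{\alpha}{n}}\Big(\frac1{|Q|}\int_Q|f|^r\Big)^{\frac1r}\Big(\frac1{|Q|}\int_Q|g|^s\Big)^{\frac1s},$$ the supremum being over all cubes $Q$ (with sides parallel to the axes) that contain $x$. A weight is a non-negative, locally integrable function on $\mathbb R^n$. Let $\mathsf A_\infty=\bigcup_{1<p<\infty}\mathsf A_p$, where $\mathsf A_p$ consists of the weights $w$ with $$\sup_Q\Big(\frac1{|Q|}\int_Q w\Big)\Big(\frac1{|Q|}\int_Q w^{1-p'}\Big)^{p-1}<\infty,\qquad p'=\frac{p}{p-1},$$ and let $\mathsf{RH}_\infty$ consist of the weights $w$ for which there is a constant $K$ with $w(x)\le K\frac1{|Q|}\int_Q w$ for all cubes $Q$ and almost every $x\in Q$. Let $0<q\le1$, $1\le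 r,s<\infty$ and $1\le m\le\infty$ satisfy $$\frac1r+\frac1s=1+\frac1{qm}$$ (with $\frac1{qm}=0$ if $m=\infty$), and let $m'\in[1,\infty]$ be given by $\frac1m+\frac1{m'}=1$. Let $w$ be a weight with $w^{m'}\in\mathsf A_\infty$, a condition understood as $w\in\mathsf{RH}_\infty$ when $m'=\infty$. Then there is a finite constant $C$, independent of $f$ and $g$, such that for all measurable $f,g:\mathbb R^n\to\mathbb C$ $$\int_{\mathbb R^n}\bigl|BI_\alpha(f,g)(x)\bigr|^q\,w(x)\,dx\le C\int_{\mathbb R^n}\mathcal M_\alpha^{r,s}(f,g)(x)^q\,w(x)\,dx.$$ Moreover, whenever the right-hand side is finite, the integral defining $BI_\alpha(f,g)(x)$ converges absolutely for almost every $x$ with respect to $w(x)\,dx$. (Where that integral does not converge absolutely, $BI_\alpha(f,g)(x)$ is given the value $0$.) -/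

import Mathlib

open MeasureTheory
open scoped ENNReal NNReal

noncomputable section

namespace BilinearFractional

/-- The half-open cube with sides parallel to the axes, lower corner `c` and side length `l`
(a genuine cube only when `0 < l`). -/
def cube {n : ℕ} (c : EuclideanSpace ℝ (Fin n)) (l : ℝ) : Set (EuclideanSpace ℝ (Fin n)) :=
  {x | ∀ i, x i ∈ Set.Ico (c i) (c i + l)}

/-- The average `(1 / |Q|) ∫_Q h` of a `[0, ∞]`-valued function over the cube `Q = cube c l`. -/
def avg {n : ℕ} (c : EuclideanSpace ℝ (Fin n)) (l : ℝ)
    (h : EuclideanSpace ℝ (Fin n) → ℝ≥0∞) : ℝ≥0∞ :=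
  (∫⁻ y in cube c l, h y) / volume (cube c l)

/-- The integrand `y ↦ f (x - y) g (x + y) / |y| ^ (n - α)`, `|y|` being the Euclidean norm. -/
def BIIntegrand {n : ℕ} (α : ℝ) (f g : EuclideanSpace ℝ (Fin n) → ℂ)
    (x y : EuclideanSpace ℝ (Fin n)) : ℂ :=
  f (x - y) * g (x + y) / ((‖y‖ ^ ((n : ℝ) - α) : ℝ) : ℂ)

/-- The bilinear fractional integral operator
`BI_α (f, g) (x) = ∫ f (x - y) g (x + y) / |y| ^ (n - α) dy`. -/
def BI {n : ℕ} (α : ℝ) (f g : EuclideanSpace ℝ (Fin n) → ℂ)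
    (x : EuclideanSpace ℝ (Fin n)) : ℂ :=
  ∫ y, BIIntegrand α f g x y

/-- The maximal operator `M_α^{r,s} (f, g) (x)`, the supremum over all cubes `Q` containing `x` of
`|Q| ^ (α / n) (⨍_Q |f| ^ r) ^ (1 / r) (⨍_Q |g| ^ s) ^ (1 / s)`, with values in `[0, ∞]`. -/
def maximal {n : ℕ} (α r s : ℝ) (f g : EuclideanSpace ℝ (Fin n) → ℂ)
    (x : EuclideanSpace ℝ (Fin n)) : ℝ≥0∞ :=
  ⨆ (c : EuclideanSpace ℝ (Fin n)) (l : ℝ) (_ : 0 < l) (_ : x ∈ cube c l),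
    volume (cube c l) ^ (α / n) *
      (avg c l fun y => ‖f y‖ₑ ^ r) ^ (1 / r) * (avg c l fun y => ‖g y‖ₑ ^ s) ^ (1 / s)

/-- A weight: a non-negative, locally integrable function. -/
structure IsWeight {n : ℕ} (w : EuclideanSpace ℝ (Fin n) → ℝ) : Prop where
  nonneg : ∀ x, 0 ≤ w x
  locallyIntegrable : LocallyIntegrable w

/-- The Muckenhoupt class `A_p`, for `1 < p < ∞`: the weights `w` with
`sup_Q (⨍_Q w) (⨍_Q w ^ (1 - p')) ^ (p - 1) < ∞`, where `p' = p / (p - 1)`.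
Here `0 ^ (1 - p') = ∞` and `0 * ∞ = 0`, so such a `w` is positive almost everywhere or zero
almost everywhere. -/
def MuckenhouptA {n : ℕ} (p : ℝ) (w : EuclideanSpace ℝ (Fin n) → ℝ) : Prop :=
  IsWeight w ∧ ∃ K : ℝ≥0, ∀ (c : EuclideanSpace ℝ (Fin n)) (l : ℝ), 0 < l →
    (avg c l fun x => ENNReal.ofReal (w x)) *
      (avg c l fun x => ENNReal.ofReal (w x) ^ (1 - p / (p - 1))) ^ (p - 1) ≤ K

/-- The Muckenhoupt class `A_∞`, the union of the classes `A_p` over `1 < p < ∞`. -/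
def MuckenhouptAInfty {n : ℕ} (w : EuclideanSpace ℝ (Fin n) → ℝ) : Prop :=
  ∃ p : ℝ, 1 < p ∧ MuckenhouptA p w

/-- The reverse Hölder class `RH_∞`: the weights `w` such that, for some constant `K` and every
cube `Q`, `w x ≤ K ⨍_Q w` for almost every `x ∈ Q`. -/
def ReverseHolderInfty {n : ℕ} (w : EuclideanSpace ℝ (Fin n) → ℝ) : Prop :=
  IsWeight w ∧ ∃ K : ℝ≥0, ∀ (c : EuclideanSpace ℝ (Fin n)) (l : ℝ), 0 < l →
    ∀ᵐ x ∂(volume.restrict (cube c l)),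
      ENNReal.ofReal (w x) ≤ K * avg c l fun y => ENNReal.ofReal (w y)

/-- The condition `w ^ t ∈ A_∞` for an exponent `t ∈ [1, ∞]`, understood as `w ∈ RH_∞` when
`t = ∞`. -/
def PowMemAInfty {n : ℕ} (t : ℝ≥0∞) (w : EuclideanSpace ℝ (Fin n) → ℝ) : Prop :=
  (t ≠ ∞ → MuckenhouptAInfty fun x => w x ^ t.toReal) ∧ (t = ∞ → ReverseHolderInfty w)

end BilinearFractional

end

/-!
All estimates are made in `[0, ∞]` for `F = |f|` and `G = |g|`. Write `W` for the density of the
weight, `θ = 1 / (q m)`, and `Q` for a lattice cube of side `2 ^ k`, that is, one of the cubes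
`2 ^ k (j + [0, 1) ^ n)`.

Cutting the kernel at the scales `2 ^ k` and using `q ≤ 1`, one has to sum
`2 ^ (k (α - n) q) ∫_Q T_k ^ q W` over all `k` and all `Q` of side `2 ^ k`, where `T_k` is the
integral of `F (x - y) G (x + y)` over `|y| ≤ 2 ^ k`. On `Q` the function `T_k` only depends on the
restrictions of `F` and `G` to `3Q`. Hölder's inequality for three factors, the pointwise form of
Young's inequality, bounds it by powers of `∫_{3Q} F ^ r`, `∫_{3Q} G ^ s` and of a function with
integral at most the product of those two, the last of these to the power `θ`.

The weight enters through `ReverseHolderOnLargeSubsets` alone: the `L ^ m'` average of `W` over `Q`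
is at most a constant times `|Q|⁻¹ ∫_E W` whenever `E ⊆ Q` covers all but a small proportion of `Q`.
For `W ^ m' ∈ A_∞` this is Hölder's inequality applied to a product of a positive and a negative
power of `W`; for `W ∈ RH_∞` it is immediate from the definition. The result is
`setLIntegral_bilinearTruncation_rpow_le`: the term of `Q` is at most a constant times
`2 ^ (k α q) a_Q ^ q ∫_E W`, where
`a_Q = (⨍_{3Q} F ^ r) ^ (1 / r) (⨍_{3Q} G ^ s) ^ (1 / s)`.

The set `E` is taken to be `mainPart`: the points of `Q` that lie in no lattice cube `P` of side at
most `2 ^ k` for which the average of `F ^ r` or `G ^ s` over `3P` exceeds `B` times the one over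
`5Q`. By the Vitali covering lemma
(`volume_exceptionalSet_le`) it covers as much of `Q` as desired if `B` is large. Fix now a point
`x`, and let `k₀` be the largest of any finite set of scales for which `x` lies in the main part of
its cube. All the numbers `a_Q` for smaller cubes around `x` are then bounded, up to a constant, by their
analogue on `5Q₀`, `Q₀` being the cube of side `2 ^ k₀` around `x`, so that the sum over these scales is a
geometric series in `2 ^ (k α q)`, of size at most a constant times `M (f, g) (x) ^ q`
(`tsum_mainPart_le_maximal`). No nested grid and no selection of maximal cubes is needed.
-/

noncomputable section

namespace BilinearFractional

/-! ### Cubes and lattice cubes -/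

variable {n : ℕ}

theorem cube_eq_preimage (c : EuclideanSpace ℝ (Fin n)) (l : ℝ) :
    cube c l = (WithLp.ofLp) ⁻¹' Set.univ.pi fun i => Set.Ico (c i) (c i + l) := by
  ext x
  simp [cube]

theorem measurableSet_cube (c : EuclideanSpace ℝ (Fin n)) (l : ℝ) : MeasurableSet (cube c l) := by
  rw [cube_eq_preimage]
  exact (MeasurableSet.univ_pi fun i => measurableSet_Ico).preimage
    (WithLp.measurable_ofLp 2 (Fin n → ℝ))

theorem volume_cube (c : EuclideanSpace ℝ (Fin n)) (l : ℝ) :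
    volume (cube c l) = ENNReal.ofReal l ^ n := by
  rw [cube_eq_preimage, (PiLp.volume_preserving_ofLp (Fin n)).measure_preimage
    (MeasurableSet.univ_pi fun i => measurableSet_Ico).nullMeasurableSet, Real.volume_pi_Ico]
  simp

theorem volume_cube_ne_top (c : EuclideanSpace ℝ (Fin n)) (l : ℝ) : volume (cube c l) ≠ ∞ := by
  rw [volume_cube]
  exact ENNReal.pow_ne_top ENNReal.ofReal_ne_top

theorem volume_cube_ne_zero (c : EuclideanSpace ℝ (Fin n)) {l : ℝ} (hl : 0 < l) :
    volume (cube c l) ≠ 0 := by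
  rw [volume_cube]
  exact pow_ne_zero _ (by simpa using hl)

theorem avg_mul_volume (c : EuclideanSpace ℝ (Fin n)) {l : ℝ} (hl : 0 < l)
    (h : EuclideanSpace ℝ (Fin n) → ℝ≥0∞) :
    avg c l h * volume (cube c l) = ∫⁻ y in cube c l, h y :=
  ENNReal.div_mul_cancel (volume_cube_ne_zero c hl) (volume_cube_ne_top c l)

/-- The lower corner of `dilatedCube a k j`. -/
def dilatedCorner (a : ℝ) (k : ℤ) (j : Fin n → ℤ) : EuclideanSpace ℝ (Fin n) :=
  WithLp.toLp 2 fun i => (2 : ℝ) ^ k * (j i - a)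

/-- The side length of `dilatedCube a k j`. -/
def dilatedSide (a : ℝ) (k : ℤ) : ℝ := (2 : ℝ) ^ k * (1 + 2 * a)

/-- The dilation by the factor `1 + 2 a`, about its centre, of the lattice cube of side `2 ^ k`
with lower corner `2 ^ k j`. In particular `a = 0` gives the lattice cube itself. -/
def dilatedCube (a : ℝ) (k : ℤ) (j : Fin n → ℤ) : Set (EuclideanSpace ℝ (Fin n)) :=
  cube (dilatedCorner a k j) (dilatedSide a k)

theorem mem_dilatedCube {a : ℝ} {k : ℤ} {j : Fin n → ℤ} {x : EuclideanSpace ℝ (Fin n)} :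
    x ∈ dilatedCube a k j ↔
      ∀ i, (2 : ℝ) ^ k * (j i - a) ≤ x i ∧ x i < (2 : ℝ) ^ k * (j i + 1 + a) := by
  refine forall_congr' fun i => ?_
  simp only [dilatedCorner, dilatedSide, Set.mem_Ico]
  have : (2 : ℝ) ^ k * (j i - a) + (2 : ℝ) ^ k * (1 + 2 * a) = (2 : ℝ) ^ k * (j i + 1 + a) := by
    ring
  rw [this]

theorem dilatedSide_pos {a : ℝ} (ha : 0 ≤ a) (k : ℤ) : 0 < dilatedSide a k := by
  unfold dilatedSide; positivity

theorem measurableSet_dilatedCube (a : ℝ) (k : ℤ) (j : Fin n → ℤ) :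
    MeasurableSet (dilatedCube a k j) := measurableSet_cube _ _

theorem volume_dilatedCube {a : ℝ} (k : ℤ) (j : Fin n → ℤ) :
    volume (dilatedCube a k j) = ENNReal.ofReal (1 + 2 * a) ^ n * ENNReal.ofReal (2 ^ k) ^ n := by
  rw [dilatedCube, volume_cube, dilatedSide, ENNReal.ofReal_mul (by positivity), mul_pow, mul_comm]

theorem volume_latticeCube (k : ℤ) (j : Fin n → ℤ) :
    volume (dilatedCube 0 k j) = ENNReal.ofReal (2 ^ k) ^ n := by
  simp [volume_dilatedCube]

theorem volume_dilatedCube_eq_mul {a : ℝ} (k : ℤ) (j : Fin n → ℤ) :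
    volume (dilatedCube a k j) = ENNReal.ofReal (1 + 2 * a) ^ n * volume (dilatedCube 0 k j) := by
  rw [volume_dilatedCube, volume_latticeCube]

theorem volume_dilatedCube_ne_top (a : ℝ) (k : ℤ) (j : Fin n → ℤ) :
    volume (dilatedCube a k j) ≠ ∞ := volume_cube_ne_top _ _

theorem volume_dilatedCube_ne_zero {a : ℝ} (ha : 0 ≤ a) (k : ℤ) (j : Fin n → ℤ) :
    volume (dilatedCube a k j) ≠ 0 := volume_cube_ne_zero _ (dilatedSide_pos ha k)

/-- The average of `h` over `dilatedCube a k j`. -/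
def dilatedAvg (a : ℝ) (k : ℤ) (j : Fin n → ℤ) (h : EuclideanSpace ℝ (Fin n) → ℝ≥0∞) : ℝ≥0∞ :=
  avg (dilatedCorner a k j) (dilatedSide a k) h

theorem dilatedAvg_mul_volume {a : ℝ} (ha : 0 ≤ a) (k : ℤ) (j : Fin n → ℤ)
    (h : EuclideanSpace ℝ (Fin n) → ℝ≥0∞) :
    dilatedAvg a k j h * volume (dilatedCube a k j) = ∫⁻ y in dilatedCube a k j, h y :=
  avg_mul_volume _ (dilatedSide_pos ha k) h

theorem dilatedCube_subset {a b : ℝ} (hab : a ≤ b) (k : ℤ) (j : Fin n → ℤ) :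
    dilatedCube a k j ⊆ dilatedCube b k j := by
  intro x hx
  rw [mem_dilatedCube] at hx ⊢
  have hp : (0 : ℝ) < 2 ^ k := by positivity
  intro i
  constructor
  · refine le_trans ?_ (hx i).1; gcongr
  · refine (hx i).2.trans_le ?_; gcongr

/-- The index of the lattice cube of side `2 ^ k` that contains `x`. -/
def latticeIndex (k : ℤ) (x : EuclideanSpace ℝ (Fin n)) : Fin n → ℤ := fun i => ⌊x i / 2 ^ k⌋

theorem mem_latticeCube_iff {k : ℤ} {j : Fin n → ℤ} {x : EuclideanSpace ℝ (Fin n)} :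
    x ∈ dilatedCube 0 k j ↔ latticeIndex k x = j := by
  have hp : (0 : ℝ) < 2 ^ k := by positivity
  rw [mem_dilatedCube, funext_iff]
  refine forall_congr' fun i => ?_
  rw [latticeIndex, Int.floor_eq_iff, le_div_iff₀ hp, div_lt_iff₀ hp]
  simp [mul_comm]

theorem pairwise_disjoint_latticeCube (k : ℤ) :
    Pairwise (Function.onFun Disjoint fun j : Fin n → ℤ => dilatedCube 0 k j) := by
  intro j j' hne
  refine Set.disjoint_left.2 fun x hx hx' => hne ?_
  rw [mem_latticeCube_iff] at hx hx'
  rw [← hx, hx']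

theorem iUnion_latticeCube (k : ℤ) : ⋃ j : Fin n → ℤ, dilatedCube 0 k j = Set.univ :=
  Set.eq_univ_of_forall fun x => Set.mem_iUnion.2 ⟨latticeIndex k x, mem_latticeCube_iff.2 rfl⟩

theorem lintegral_eq_tsum_latticeCube (k : ℤ) (h : EuclideanSpace ℝ (Fin n) → ℝ≥0∞) :
    ∫⁻ x, h x = ∑' j : Fin n → ℤ, ∫⁻ x in dilatedCube 0 k j, h x := by
  rw [← lintegral_iUnion (fun j => measurableSet_dilatedCube 0 k j)
    (pairwise_disjoint_latticeCube k), iUnion_latticeCube, Measure.restrict_univ]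

/-- If `x` lies in a lattice cube of side `2 ^ k` and `‖y‖ ≤ 2 ^ k`, then `x + y` lies in the
threefold dilation of that cube. -/
theorem add_mem_dilatedCube {k : ℤ} {j : Fin n → ℤ} {x y : EuclideanSpace ℝ (Fin n)}
    (hx : x ∈ dilatedCube 0 k j) (hy : ‖y‖ ≤ 2 ^ k) : x + y ∈ dilatedCube 1 k j := by
  rw [mem_dilatedCube] at hx ⊢
  intro i
  have h1 := hx i
  have h2 : |y i| ≤ 2 ^ k := (PiLp.norm_apply_le y i).trans hy
  rw [abs_le] at h2
  simp only [PiLp.add_apply]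
  constructor <;> nlinarith

/-- A lattice cube, dilated threefold, that meets a lattice cube at least as large lies in the
fivefold dilation of the latter. -/
theorem dilatedCube_one_subset {i k : ℤ} (hik : i ≤ k) {j' j : Fin n → ℤ}
    (hne : (dilatedCube 0 i j' ∩ dilatedCube 0 k j).Nonempty) :
    dilatedCube 1 i j' ⊆ dilatedCube 2 k j := by
  obtain ⟨z, hz, hz'⟩ := hne
  intro x hx
  rw [mem_dilatedCube] at hz hz' hx ⊢
  have hp : (2 : ℝ) ^ i ≤ 2 ^ k := zpow_le_zpow_right₀ (by norm_num) hik
  intro m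
  have h1 := hz m
  have h2 := hz' m
  have h3 := hx m
  constructor <;> nlinarith

/-- If the threefold dilations of two lattice cubes meet and the first is no larger than the
second, then the first lies in the ninefold dilation of the second. -/
theorem latticeCube_subset_of_inter {i k : ℤ} (hik : i ≤ k) {j' j : Fin n → ℤ}
    (hne : (dilatedCube 1 i j' ∩ dilatedCube 1 k j).Nonempty) :
    dilatedCube 0 i j' ⊆ dilatedCube 4 k j := by
  obtain ⟨z, hz, hz'⟩ := hne
  intro x hx
  rw [mem_dilatedCube] at hz hz' hx ⊢
  have hp : (2 : ℝ) ^ i ≤ 2 ^ k := zpow_le_zpow_right₀ (by norm_num) hik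
  intro m
  have h1 := hz m
  have h2 := hz' m
  have h3 := hx m
  constructor <;> nlinarith

/-! ### A weak-type estimate on a fixed cube -/

/-- The union of the lattice cubes that are no larger than the cube `Q` with index `(k, j)`, that
meet `Q`, and over whose threefold dilation the average of `h` exceeds `t`. -/
def exceptionalSet (h : EuclideanSpace ℝ (Fin n) → ℝ≥0∞) (k : ℤ) (j : Fin n → ℤ) (t : ℝ≥0∞) :
    Set (EuclideanSpace ℝ (Fin n)) :=
  ⋃ p ∈ {p : ℤ × (Fin n → ℤ) | p.1 ≤ k ∧ (dilatedCube 0 p.1 p.2 ∩ dilatedCube 0 k j).Nonempty ∧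
    t < dilatedAvg 1 p.1 p.2 h}, dilatedCube 0 p.1 p.2

theorem measurableSet_exceptionalSet (h : EuclideanSpace ℝ (Fin n) → ℝ≥0∞) (k : ℤ)
    (j : Fin n → ℤ) (t : ℝ≥0∞) : MeasurableSet (exceptionalSet h k j t) :=
  MeasurableSet.biUnion (Set.to_countable _) fun _ _ => measurableSet_dilatedCube _ _ _

/-- The weak-type bound for the maximal function over lattice cubes, by the Vitali covering
lemma. -/
theorem mul_volume_exceptionalSet_le (h : EuclideanSpace ℝ (Fin n) → ℝ≥0∞) (k : ℤ)
    (j : Fin n → ℤ) (t : ℝ≥0∞) :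
    t * volume (exceptionalSet h k j t) ≤ 3 ^ n * ∫⁻ x in dilatedCube 2 k j, h x := by
  set T := {p : ℤ × (Fin n → ℤ) | p.1 ≤ k ∧ (dilatedCube 0 p.1 p.2 ∩ dilatedCube 0 k j).Nonempty ∧
    t < dilatedAvg 1 p.1 p.2 h} with hT
  -- The enlargement factor `3 / 2` forces comparable powers of two to be ordered.
  obtain ⟨u, hu, hdisj, hcov⟩ := Vitali.exists_disjoint_subfamily_covering_enlargement
    (fun p : ℤ × (Fin n → ℤ) => dilatedCube 1 p.1 p.2) T (fun p => (2 : ℝ) ^ p.1) (3 / 2)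
    (by norm_num) (fun p _ => by positivity) (2 ^ k)
    (fun p hp => zpow_le_zpow_right₀ (by norm_num) hp.1)
    (fun p hp => (hp.2.1.mono Set.inter_subset_left).mono (dilatedCube_subset (by norm_num) _ _))
  have hsub : exceptionalSet h k j t ⊆ ⋃ p ∈ u, dilatedCube 4 p.1 p.2 := by
    refine Set.iUnion₂_subset fun p hp => ?_
    obtain ⟨b, hb, hne, hle⟩ := hcov p hp
    refine Set.Subset.trans (latticeCube_subset_of_inter ?_ hne)
      (Set.subset_biUnion_of_mem (u := fun p : ℤ × (Fin n → ℤ) => dilatedCube 4 p.1 p.2) hb)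
    by_contra! hlt
    have h1 : (2 : ℝ) ^ (b.1 + 1) ≤ 2 ^ p.1 := zpow_le_zpow_right₀ (by norm_num) (by lia)
    rw [zpow_add₀ (by norm_num)] at h1
    have h2 : (0 : ℝ) < 2 ^ b.1 := by positivity
    linarith
  have hvol : ∀ p : ℤ × (Fin n → ℤ), volume (dilatedCube 4 p.1 p.2)
      = 3 ^ n * volume (dilatedCube 1 p.1 p.2) := by
    intro p
    have h9 : ENNReal.ofReal (1 + 2 * 4) = 3 * ENNReal.ofReal (1 + 2 * 1) := by
      rw [← ENNReal.ofReal_ofNat, ← ENNReal.ofReal_mul (by norm_num)]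
      norm_num
    rw [volume_dilatedCube, volume_dilatedCube, h9, mul_pow, mul_assoc]
  calc t * volume (exceptionalSet h k j t)
      ≤ t * ∑' p : u, volume (dilatedCube 4 p.1.1 p.1.2) := by
        gcongr
        exact (measure_mono hsub).trans (measure_biUnion_le _ (Set.to_countable _) _)
    _ = 3 ^ n * ∑' p : u, t * volume (dilatedCube 1 p.1.1 p.1.2) := by
        simp_rw [hvol, ENNReal.tsum_mul_left]
        ring
    _ ≤ 3 ^ n * ∑' p : u, ∫⁻ x in dilatedCube 1 p.1.1 p.1.2, h x := by
        gcongr with p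
        rw [← dilatedAvg_mul_volume zero_le_one]
        gcongr
        exact (hu p.2).2.2.le
    _ = 3 ^ n * ∫⁻ x in ⋃ p ∈ u, dilatedCube 1 p.1 p.2, h x := by
        rw [lintegral_biUnion (Set.to_countable _) (fun _ _ => measurableSet_dilatedCube _ _ _)
          hdisj]
    _ ≤ 3 ^ n * ∫⁻ x in dilatedCube 2 k j, h x := by
        gcongr
        exact Set.iUnion₂_subset fun p hp => dilatedCube_one_subset (hu hp).1 (hu hp).2.1

theorem volume_exceptionalSet_le (h : EuclideanSpace ℝ (Fin n) → ℝ≥0∞) (k : ℤ)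
    (j : Fin n → ℤ) {B : ℝ≥0∞} (hB : B ≠ 0) :
    B * volume (exceptionalSet h k j (B * dilatedAvg 2 k j h)) ≤
      15 ^ n * volume (dilatedCube 0 k j) := by
  have hkey := mul_volume_exceptionalSet_le h k j (B * dilatedAvg 2 k j h)
  rw [← dilatedAvg_mul_volume zero_le_two, volume_dilatedCube_eq_mul] at hkey
  rcases eq_or_ne (dilatedAvg 2 k j h) 0 with h0 | h0
  · -- then `h` vanishes on the dilated cube, so no cube is selected
    have : exceptionalSet h k j (B * dilatedAvg 2 k j h) = ∅ := by
      refine Set.eq_empty_of_forall_notMem fun x hx => ?_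
      obtain ⟨p, hp, -⟩ := Set.mem_iUnion₂.1 hx
      refine absurd hp.2.2 ?_
      have h1 : ∫⁻ x in dilatedCube 1 p.1 p.2, h x ≤ ∫⁻ x in dilatedCube 2 k j, h x :=
        lintegral_mono_set (dilatedCube_one_subset hp.1 hp.2.1)
      rw [← dilatedAvg_mul_volume zero_le_two, ← dilatedAvg_mul_volume zero_le_one, h0, zero_mul,
        nonpos_iff_eq_zero, mul_eq_zero] at h1
      simp [h1.resolve_right (volume_dilatedCube_ne_zero zero_le_one _ _)]
    simp [this]
  rcases eq_or_ne (dilatedAvg 2 k j h) ∞ with h1 | h1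
  · -- the threshold is infinite, so no cube is selected
    have : exceptionalSet h k j (B * dilatedAvg 2 k j h) = ∅ := by
      refine Set.eq_empty_of_forall_notMem fun x hx => ?_
      obtain ⟨p, hp, -⟩ := Set.mem_iUnion₂.1 hx
      refine absurd hp.2.2 ?_
      simp [h1, ENNReal.mul_top hB]
    simp [this]
  · rw [← ENNReal.mul_le_mul_iff_right h0 h1]
    calc _ = B * dilatedAvg 2 k j h *
          volume (exceptionalSet h k j (B * dilatedAvg 2 k j h)) := by ring
      _ ≤ _ := hkey
      _ = _ := by
        have : (15 : ℝ≥0∞) ^ n = 3 ^ n * ENNReal.ofReal (1 + 2 * 2) ^ n := by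
          rw [← mul_pow]; norm_num
        rw [this]; ring

/-! ### The weight condition -/

/-- The only consequence of the hypothesis on the weight that the argument uses. For a density `W`
and `μ = 1 / m` it says that
`(⨍_Q W ^ m') ^ (1 / m') ≤ C |Q|⁻¹ ∫_E W` for every measurable subset `E` of a cube `Q` that misses
at most the proportion `ε` of `Q`; the left side enters in its dual form, tested against functions
`H ^ μ`, so that `m' = ∞` needs no separate formulation. -/
def ReverseHolderOnLargeSubsets (μ : ℝ) (W : EuclideanSpace ℝ (Fin n) → ℝ≥0∞) : Prop :=
  ∃ ε : ℝ≥0, 0 < ε ∧ ∃ C : ℝ≥0, ∀ (c : EuclideanSpace ℝ (Fin n)) (l : ℝ), 0 < l →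
    ∀ E ⊆ cube c l, MeasurableSet E → volume (cube c l \ E) ≤ ε * volume (cube c l) →
      ∀ H : EuclideanSpace ℝ (Fin n) → ℝ≥0∞, Measurable H →
        volume (cube c l) ^ μ * ∫⁻ x in cube c l, H x ^ μ * W x ≤
          C * (∫⁻ x in cube c l, H x) ^ μ * ∫⁻ x in E, W x

theorem cube_subset_isCompact (c : EuclideanSpace ℝ (Fin n)) (l : ℝ) :
    ∃ K, IsCompact K ∧ cube c l ⊆ K := by
  refine ⟨_, (PiLp.continuousLinearEquiv 2 ℝ fun _ : Fin n => ℝ).toHomeomorph.isCompact_preimage.2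
    (isCompact_univ_pi fun i => isCompact_Icc (a := c i) (b := c i + l)), fun x hx => ?_⟩
  exact fun i _ => Set.Ico_subset_Icc_self (hx i)

theorem IsWeight.aemeasurable {w : EuclideanSpace ℝ (Fin n) → ℝ} (hw : IsWeight w) :
    AEMeasurable (fun x => ENNReal.ofReal (w x)) :=
  hw.locallyIntegrable.aestronglyMeasurable.aemeasurable.ennreal_ofReal

theorem IsWeight.lintegral_cube_ne_top {w : EuclideanSpace ℝ (Fin n) → ℝ} (hw : IsWeight w)
    (c : EuclideanSpace ℝ (Fin n)) (l : ℝ) : ∫⁻ x in cube c l, ENNReal.ofReal (w x) ≠ ∞ := by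
  obtain ⟨K, hK, hcK⟩ := cube_subset_isCompact c l
  exact ((hw.locallyIntegrable.integrableOn_isCompact hK).mono_set hcK).lintegral_lt_top.ne

theorem ReverseHolderInfty.reverseHolderOnLargeSubsets {w : EuclideanSpace ℝ (Fin n) → ℝ}
    (hw : ReverseHolderInfty w) :
    ReverseHolderOnLargeSubsets 1 fun x => ENNReal.ofReal (w x) := by
  obtain ⟨hweight, K, hK⟩ := hw
  refine ⟨(2 * (K + 1))⁻¹, by positivity, 2 * K, fun c l hl E hE hEm hvol H hH => ?_⟩
  set W : EuclideanSpace ℝ (Fin n) → ℝ≥0∞ := fun x => ENNReal.ofReal (w x) with hW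
  have hsup := hK c l hl
  have hfin : ∫⁻ x in cube c l, W x ≠ ∞ := hweight.lintegral_cube_ne_top c l
  have hsmall : ∫⁻ x in cube c l \ E, W x ≤ 2⁻¹ * ∫⁻ x in cube c l, W x := by
    calc ∫⁻ x in cube c l \ E, W x
        ≤ ∫⁻ x in cube c l \ E, K * avg c l W :=
          lintegral_mono_ae (ae_mono (Measure.restrict_mono Set.sdiff_subset le_rfl) hsup)
      _ = K * avg c l W * volume (cube c l \ E) := setLIntegral_const _ _
      _ ≤ K * avg c l W * (((2 * (K + 1))⁻¹ : ℝ≥0) * volume (cube c l)) := by gcongr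
      _ = (K * (2 * (K + 1))⁻¹ : ℝ≥0) * (avg c l W * volume (cube c l)) := by
          push_cast; ring
      _ ≤ _ := by
          rw [avg_mul_volume c hl]
          gcongr
          rw [← ENNReal.coe_ofNat, ← ENNReal.coe_inv (by norm_num), ENNReal.coe_le_coe, mul_inv,
            mul_left_comm]
          refine mul_le_of_le_one_right' ?_
          rw [← div_eq_mul_inv]
          exact div_le_one_of_le₀ (by simp) (by simp)
  have hlarge : ∫⁻ x in cube c l, W x ≤ 2 * ∫⁻ x in E, W x := by
    have hsplit := lintegral_inter_add_sdiff (μ := volume) W (cube c l) hEm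
    rw [Set.inter_eq_self_of_subset_right hE] at hsplit
    have hhalf : 2⁻¹ * ∫⁻ x in cube c l, W x ≠ ∞ := ENNReal.mul_ne_top (by simp) hfin
    have h1 : 2⁻¹ * (∫⁻ x in cube c l, W x) + 2⁻¹ * ∫⁻ x in cube c l, W x
        ≤ (∫⁻ x in E, W x) + 2⁻¹ * ∫⁻ x in cube c l, W x := by
      rw [← add_mul, ENNReal.inv_two_add_inv_two, one_mul]
      refine hsplit.symm.le.trans ?_
      gcongr
    rw [ENNReal.add_le_add_iff_right hhalf] at h1
    calc _ = 2 * (2⁻¹ * ∫⁻ x in cube c l, W x) := by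
          rw [← mul_assoc, ENNReal.mul_inv_cancel (by simp) (by simp), one_mul]
      _ ≤ _ := by gcongr
  simp only [ENNReal.rpow_one]
  calc volume (cube c l) * ∫⁻ x in cube c l, H x * W x
      ≤ volume (cube c l) * ∫⁻ x in cube c l, H x * (K * avg c l W) := by
        gcongr 1
        refine lintegral_mono_ae ?_
        filter_upwards [hsup] with x hx
        gcongr
    _ = K * (∫⁻ x in cube c l, H x) * (avg c l W * volume (cube c l)) := by
        rw [lintegral_mul_const _ hH]; ring
    _ ≤ K * (∫⁻ x in cube c l, H x) * (2 * ∫⁻ x in E, W x) := by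
        rw [avg_mul_volume c hl]; gcongr
    _ = _ := by push_cast; ring

/-- If `W ^ t` satisfies the `A_(ρ + 1)` inequality on `Q`, then the `L ^ t` average of `W` over `Q`
is controlled by the plain average of `W` over any subset `E` of at least half the measure. -/
theorem lintegral_rpow_le_of_muckenhoupt {Q E : Set (EuclideanSpace ℝ (Fin n))} (hEQ : E ⊆ Q)
    (hQ0 : volume Q ≠ 0) (hQt : volume Q ≠ ∞) (hE : volume Q ≤ 2 * volume E)
    {W : EuclideanSpace ℝ (Fin n) → ℝ≥0∞} (hW : AEMeasurable W) (hWt : ∀ x, W x ≠ ∞)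
    {ρ t : ℝ} (hρ : 0 < ρ) (ht : 1 ≤ t) {K : ℝ≥0}
    (hK : (∫⁻ x in Q, W x ^ t) / volume Q *
      ((∫⁻ x in Q, (W x ^ t) ^ (-(1 / ρ))) / volume Q) ^ ρ ≤ K) :
    volume Q ^ (1 - 1 / t) * (∫⁻ x in Q, W x ^ t) ^ (1 / t) ≤
      (2 ^ (ρ + t) * (K : ℝ≥0∞)) ^ (1 / t) * ∫⁻ x in E, W x := by
  have ht0 : 0 < t := by linarith
  set V := volume Q
  set U := ∫⁻ x in Q, W x ^ t with hU
  set S := ∫⁻ x in Q, (W x ^ t) ^ (-(1 / ρ)) with hS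
  rcases eq_or_ne U 0 with hU0 | hU0
  · rw [hU0, ENNReal.zero_rpow_of_pos (by positivity), mul_zero]
    exact zero_le
  have hUV : U / V ≠ 0 := (ENNReal.div_pos hU0 hQt).ne'
  have hSt : S ≠ ∞ := by
    intro hS
    rw [hS, ENNReal.top_div_of_ne_top hQt, ENNReal.top_rpow_of_pos hρ, ENNReal.mul_top hUV] at hK
    exact ENNReal.coe_ne_top (top_le_iff.1 hK)
  -- `0` to a negative power is `∞`, so finiteness of `S` excludes zeros of `W`.
  have hWpos : ∀ᵐ x ∂(volume.restrict Q), W x ≠ 0 := by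
    have hm : AEMeasurable (fun x => (W x ^ t) ^ (-(1 / ρ))) (volume.restrict Q) :=
      ((hW.restrict).pow_const _).pow_const _
    filter_upwards [ae_lt_top' hm hSt] with x hx h0
    rw [h0, ENNReal.zero_rpow_of_pos ht0, ENNReal.zero_rpow_of_neg (by simpa using hρ)] at hx
    exact lt_irrefl _ hx
  -- Hölder's inequality for `1 = W ^ a * (W ^ (-t / ρ)) ^ b`
  have hab : t / (ρ + t) + ρ / (ρ + t) = 1 := by field_simp; ring
  have hholder : volume E ≤ (∫⁻ x in E, W x) ^ (t / (ρ + t)) * S ^ (ρ / (ρ + t)) := by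
    calc volume E = ∫⁻ x in E, 1 := by simp
      _ = ∫⁻ x in E, W x ^ (t / (ρ + t)) * ((W x ^ t) ^ (-(1 / ρ))) ^ (ρ / (ρ + t)) := by
          refine lintegral_congr_ae ?_
          filter_upwards [ae_mono (Measure.restrict_mono hEQ le_rfl) hWpos] with x hx
          rw [← ENNReal.rpow_mul, ← ENNReal.rpow_mul, ← ENNReal.rpow_add _ _ hx (hWt x)]
          have : t / (ρ + t) + t * (-(1 / ρ) * (ρ / (ρ + t))) = 0 := by field_simp; ring
          rw [this, ENNReal.rpow_zero]
      _ ≤ (∫⁻ x in E, W x) ^ (t / (ρ + t)) *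
            (∫⁻ x in E, (W x ^ t) ^ (-(1 / ρ))) ^ (ρ / (ρ + t)) :=
          ENNReal.lintegral_mul_norm_pow_le hW.restrict
            ((hW.restrict.pow_const _).pow_const _) (by positivity) (by positivity) hab
      _ ≤ _ := by gcongr; exact lintegral_mono_set hEQ
  have h1 : volume E ^ (ρ + t) ≤ (∫⁻ x in E, W x) ^ t * S ^ ρ := by
    calc volume E ^ (ρ + t)
        ≤ ((∫⁻ x in E, W x) ^ (t / (ρ + t)) * S ^ (ρ / (ρ + t))) ^ (ρ + t) := by gcongr
      _ = _ := by
        rw [ENNReal.mul_rpow_of_nonneg _ _ (by positivity), ← ENNReal.rpow_mul, ← ENNReal.rpow_mul,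
          div_mul_cancel₀ _ (by positivity), div_mul_cancel₀ _ (by positivity)]
  have h2 : U * S ^ ρ ≤ K * V ^ (1 + ρ) := by
    calc U * S ^ ρ = (U / V * (S / V) ^ ρ) * V ^ (1 + ρ) := by
          rw [ENNReal.rpow_add _ _ hQ0 hQt, ENNReal.rpow_one]
          calc U * S ^ ρ = (U / V * V) * (S / V * V) ^ ρ := by
                rw [ENNReal.div_mul_cancel hQ0 hQt, ENNReal.div_mul_cancel hQ0 hQt]
            _ = _ := by rw [ENNReal.mul_rpow_of_nonneg _ _ hρ.le]; ring
      _ ≤ _ := by gcongr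
  have h3 : U * V ^ (t - 1) ≤ 2 ^ (ρ + t) * K * (∫⁻ x in E, W x) ^ t := by
    have hV0 : V ^ (1 + ρ) ≠ 0 := (ENNReal.rpow_pos (pos_iff_ne_zero.2 hQ0) hQt).ne'
    have hVt : V ^ (1 + ρ) ≠ ∞ := ENNReal.rpow_ne_top_of_nonneg (by positivity) hQt
    rw [← ENNReal.mul_le_mul_iff_left hV0 hVt]
    calc U * V ^ (t - 1) * V ^ (1 + ρ) = U * V ^ (ρ + t) := by
          rw [mul_assoc, ← ENNReal.rpow_add _ _ hQ0 hQt]; congr 2; ring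
      _ ≤ U * (2 * volume E) ^ (ρ + t) := by gcongr
      _ = 2 ^ (ρ + t) * (U * volume E ^ (ρ + t)) := by
          rw [ENNReal.mul_rpow_of_nonneg _ _ (by positivity)]; ring
      _ ≤ 2 ^ (ρ + t) * (U * ((∫⁻ x in E, W x) ^ t * S ^ ρ)) := by gcongr
      _ = 2 ^ (ρ + t) * (∫⁻ x in E, W x) ^ t * (U * S ^ ρ) := by ring
      _ ≤ 2 ^ (ρ + t) * (∫⁻ x in E, W x) ^ t * (K * V ^ (1 + ρ)) := by gcongr
      _ = _ := by ring
  calc V ^ (1 - 1 / t) * U ^ (1 / t) = (U * V ^ (t - 1)) ^ (1 / t) := by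
        rw [ENNReal.mul_rpow_of_nonneg _ _ (by positivity), ← ENNReal.rpow_mul, mul_comm]
        congr 2; field_simp
    _ ≤ (2 ^ (ρ + t) * K * (∫⁻ x in E, W x) ^ t) ^ (1 / t) := by gcongr
    _ = _ := by
        rw [ENNReal.mul_rpow_of_nonneg _ _ (by positivity), ← ENNReal.rpow_mul,
          mul_one_div_cancel ht0.ne', ENNReal.rpow_one]

theorem MuckenhouptAInfty.reverseHolderOnLargeSubsets {w : EuclideanSpace ℝ (Fin n) → ℝ}
    (hw : IsWeight w) {t : ℝ} (ht : 1 ≤ t) (hA : MuckenhouptAInfty fun x => w x ^ t) :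
    ReverseHolderOnLargeSubsets (1 - 1 / t) fun x => ENNReal.ofReal (w x) := by
  obtain ⟨p, hp, -, K, hK⟩ := hA
  have ht0 : 0 < t := by linarith
  have hCtop : (2 ^ (p - 1 + t) * (K : ℝ≥0∞)) ^ (1 / t) ≠ ∞ :=
    ENNReal.rpow_ne_top_of_nonneg (by positivity)
      (ENNReal.mul_ne_top (ENNReal.rpow_ne_top_of_nonneg (by linarith) (by simp))
        ENNReal.coe_ne_top)
  refine ⟨2⁻¹, by positivity, ((2 ^ (p - 1 + t) * (K : ℝ≥0∞)) ^ (1 / t)).toNNReal,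
    fun c l hl E hE hEm hvol H hH => ?_⟩
  rw [ENNReal.coe_toNNReal hCtop]
  set W : EuclideanSpace ℝ (Fin n) → ℝ≥0∞ := fun x => ENNReal.ofReal (w x) with hW
  have hWm : AEMeasurable W := hw.aemeasurable
  have hWt : ∀ x, ENNReal.ofReal (w x ^ t) = W x ^ t := fun x =>
    (ENNReal.ofReal_rpow_of_nonneg (hw.nonneg x) ht0.le).symm
  have hexp : 1 - p / (p - 1) = -(1 / (p - 1)) := by
    have : p - 1 ≠ 0 := by linarith
    field_simp; ring
  have hV0 := volume_cube_ne_zero c hl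
  have hVt := volume_cube_ne_top c l
  have hhalf : volume (cube c l) ≤ 2 * volume E := by
    have h1 : volume E + volume (cube c l \ E) = volume (cube c l) := by
      have := measure_inter_add_sdiff (μ := volume) (cube c l) hEm
      rwa [Set.inter_eq_self_of_subset_right hE] at this
    have h2 : 2⁻¹ * volume (cube c l) + 2⁻¹ * volume (cube c l) ≤
        volume E + 2⁻¹ * volume (cube c l) := by
      rw [← add_mul, ENNReal.inv_two_add_inv_two, one_mul]
      refine h1.symm.le.trans ?_
      gcongr
      simpa using hvol
    rw [ENNReal.add_le_add_iff_right (ENNReal.mul_ne_top (by simp) hVt)] at h2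
    calc _ = 2 * (2⁻¹ * volume (cube c l)) := by
          rw [← mul_assoc, ENNReal.mul_inv_cancel (by simp) (by simp), one_mul]
      _ ≤ _ := by gcongr
  have hmain := lintegral_rpow_le_of_muckenhoupt hE hV0 hVt hhalf hWm
    (fun x => ENNReal.ofReal_ne_top) (sub_pos.2 hp) ht (K := K) (by
      have := hK c l hl
      simp only [avg, hWt, hexp] at this
      exact this)
  have h1t : 0 ≤ 1 - 1 / t := by
    rw [sub_nonneg, div_le_one ht0]; exact ht
  calc volume (cube c l) ^ (1 - 1 / t) * ∫⁻ x in cube c l, H x ^ (1 - 1 / t) * W x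
      = volume (cube c l) ^ (1 - 1 / t) *
          ∫⁻ x in cube c l, H x ^ (1 - 1 / t) * (W x ^ t) ^ (1 / t) := by
        simp_rw [← ENNReal.rpow_mul, mul_one_div_cancel ht0.ne', ENNReal.rpow_one]
    _ ≤ volume (cube c l) ^ (1 - 1 / t) * ((∫⁻ x in cube c l, H x) ^ (1 - 1 / t) *
          (∫⁻ x in cube c l, W x ^ t) ^ (1 / t)) := by
        gcongr
        exact ENNReal.lintegral_mul_norm_pow_le hH.aemeasurable (hWm.restrict.pow_const _) h1t
          (by positivity) (by ring)
    _ = (∫⁻ x in cube c l, H x) ^ (1 - 1 / t) * (volume (cube c l) ^ (1 - 1 / t) *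
          (∫⁻ x in cube c l, W x ^ t) ^ (1 / t)) := by ring
    _ ≤ (∫⁻ x in cube c l, H x) ^ (1 - 1 / t) *
          ((2 ^ (p - 1 + t) * (K : ℝ≥0∞)) ^ (1 / t) * ∫⁻ x in E, W x) := by gcongr
    _ = _ := by ring

theorem PowMemAInfty.reverseHolderOnLargeSubsets {w : EuclideanSpace ℝ (Fin n) → ℝ}
    (hw : IsWeight w) {m : ℝ≥0∞} (hm : 1 ≤ m) (hA : PowMemAInfty (ENNReal.conjExponent m) w) :
    ReverseHolderOnLargeSubsets (m⁻¹).toReal fun x => ENNReal.ofReal (w x) := by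
  have hconj : ENNReal.HolderConjugate m (ENNReal.conjExponent m) := .conjExponent hm
  have hsum := hconj.inv_add_inv_eq_one
  set t := ENNReal.conjExponent m with ht
  have ht1 : 1 ≤ t := by simp [ht, ENNReal.conjExponent]
  by_cases htop : t = ∞
  · rw [htop, ENNReal.inv_top, add_zero] at hsum
    rw [hsum, ENNReal.toReal_one]
    exact (hA.2 htop).reverseHolderOnLargeSubsets
  · have hmu : (m⁻¹).toReal = 1 - 1 / t.toReal := by
      have hti : t⁻¹ ≠ ∞ := by simpa using (zero_lt_one.trans_le ht1).ne'
      have hmi : m⁻¹ ≠ ∞ := by simpa using (zero_lt_one.trans_le hm).ne'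
      have := congrArg ENNReal.toReal hsum
      rw [ENNReal.toReal_add hmi hti, ENNReal.toReal_inv t] at this
      simp only [ENNReal.toReal_one] at this
      rw [one_div]; linarith
    rw [hmu]
    exact (hA.1 htop).reverseHolderOnLargeSubsets hw
      (by simpa using ENNReal.toReal_mono htop ht1)

/-! ### A localized form of Young's inequality -/

/-- Hölder's inequality for the three factors of
`F G = (F ^ r G ^ s) ^ θ * (F ^ r) ^ (1 / r - θ) * (G ^ s) ^ (1 / s - θ)`. -/
theorem lintegral_mul_comp_le {F G : EuclideanSpace ℝ (Fin n) → ℝ≥0∞} (hF : Measurable F)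
    (hG : Measurable G) {r s θ : ℝ} (hr : 0 < r) (hs : 0 < s) (hθ : 0 ≤ θ) (hθr : θ ≤ 1 / r)
    (hθs : θ ≤ 1 / s) (hrs : 1 / r + 1 / s = 1 + θ) (x : EuclideanSpace ℝ (Fin n)) :
    ∫⁻ y, F (x - y) * G (x + y) ≤
      (∫⁻ y, F (x - y) ^ r * G (x + y) ^ s) ^ θ * (∫⁻ y, F y ^ r) ^ (1 / r - θ) *
        (∫⁻ y, G y ^ s) ^ (1 / s - θ) := by
  have hF' : Measurable fun y => F (x - y) := hF.comp (measurable_const.sub measurable_id)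
  have hG' : Measurable fun y => G (x + y) := hG.comp (measurable_const.add measurable_id)
  have hr0 : 0 ≤ 1 / r - θ := sub_nonneg.2 hθr
  have hs0 : 0 ≤ 1 / s - θ := sub_nonneg.2 hθs
  have key := ENNReal.lintegral_prod_norm_pow_le
    (μ := (volume : Measure (EuclideanSpace ℝ (Fin n)))) Finset.univ
    (f := ![fun y => F (x - y) ^ r * G (x + y) ^ s, fun y => F (x - y) ^ r,
      fun y => G (x + y) ^ s])
    (by
      intro i _
      fin_cases i
      · exact ((hF'.pow_const r).mul (hG'.pow_const s)).aemeasurable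
      · exact (hF'.pow_const r).aemeasurable
      · exact (hG'.pow_const s).aemeasurable)
    (p := ![θ, 1 / r - θ, 1 / s - θ])
    (by rw [Fin.sum_univ_three]; simp only [Matrix.cons_val]; linarith)
    (by
      intro i _
      fin_cases i
      · exact hθ
      · exact hr0
      · exact hs0)
  simp only [Fin.prod_univ_three, Matrix.cons_val] at key
  rw [lintegral_sub_left_eq_self (fun y => F y ^ r) x,
    lintegral_add_left_eq_self (fun y => G y ^ s) x] at key
  refine le_trans (le_of_eq (lintegral_congr fun y => ?_)) key
  rw [ENNReal.mul_rpow_of_nonneg _ _ hθ]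
  calc F (x - y) * G (x + y)
      = (F (x - y) ^ r) ^ (θ + (1 / r - θ)) * (G (x + y) ^ s) ^ (θ + (1 / s - θ)) := by
        rw [add_sub_cancel, add_sub_cancel, ← ENNReal.rpow_mul, ← ENNReal.rpow_mul,
          mul_one_div_cancel hr.ne', mul_one_div_cancel hs.ne', ENNReal.rpow_one, ENNReal.rpow_one]
    _ = _ := by
        rw [ENNReal.rpow_add_of_nonneg _ _ hθ hr0, ENNReal.rpow_add_of_nonneg _ _ hθ hs0]
        ring

theorem lintegral_comp_two_smul_le {G : EuclideanSpace ℝ (Fin n) → ℝ≥0∞} (hG : Measurable G) :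
    ∫⁻ y, G ((2 : ℝ) • y) ≤ ∫⁻ y, G y := by
  have hm : Measurable fun y : EuclideanSpace ℝ (Fin n) => (2 : ℝ) • y := measurable_const_smul _
  rw [← lintegral_map hG hm, Measure.map_addHaar_smul _ (by norm_num : (2 : ℝ) ≠ 0),
    lintegral_smul_measure, smul_eq_mul]
  refine mul_le_of_le_one_left' ?_
  rw [ENNReal.ofReal_le_one, abs_of_nonneg (by positivity)]
  exact inv_le_one_of_one_le₀ (one_le_pow₀ (by norm_num))

theorem lintegral_lintegral_mul_comp_le {F G : EuclideanSpace ℝ (Fin n) → ℝ≥0∞}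
    (hF : Measurable F) (hG : Measurable G) :
    ∫⁻ x, ∫⁻ y, F (x - y) * G (x + y) ≤ (∫⁻ y, F y) * ∫⁻ y, G y := by
  calc ∫⁻ x, ∫⁻ y, F (x - y) * G (x + y)
      = ∫⁻ y, ∫⁻ x, F (x - y) * G (x + y) := by
        refine lintegral_lintegral_swap (Measurable.aemeasurable ?_)
        exact (hF.comp (measurable_fst.sub measurable_snd)).mul
          (hG.comp (measurable_fst.add measurable_snd))
    _ = ∫⁻ y, ∫⁻ x, F x * G (x + (2 : ℝ) • y) := by
        refine lintegral_congr fun y => ?_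
        rw [← lintegral_add_right_eq_self _ y]
        refine lintegral_congr fun x => ?_
        rw [add_sub_cancel_right, add_assoc, two_smul]
    _ = ∫⁻ x, ∫⁻ y, F x * G (x + (2 : ℝ) • y) := by
        refine lintegral_lintegral_swap (Measurable.aemeasurable ?_)
        exact (hF.comp measurable_snd).mul
          (hG.comp (measurable_snd.add (measurable_fst.const_smul (2 : ℝ))))
    _ ≤ ∫⁻ x, F x * ∫⁻ y, G y := by
        refine lintegral_mono fun x => ?_
        have hGx : Measurable fun z => G (x + z) := hG.comp (measurable_const.add measurable_id)
        have hG2 : Measurable fun y => G (x + (2 : ℝ) • y) :=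
          hGx.comp (measurable_const_smul (2 : ℝ))
        rw [lintegral_const_mul _ hG2]
        gcongr 1
        exact (lintegral_comp_two_smul_le hGx).trans_eq (lintegral_add_left_eq_self G x)
    _ = _ := lintegral_mul_const _ hF

/-- The bilinear averaging operator at scale `2 ^ k`, without its normalizing factor. -/
def bilinearTruncation (F G : EuclideanSpace ℝ (Fin n) → ℝ≥0∞) (k : ℤ)
    (x : EuclideanSpace ℝ (Fin n)) : ℝ≥0∞ :=
  ∫⁻ y, (Metric.closedBall 0 (2 ^ k)).indicator (fun y => F (x - y) * G (x + y)) y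

theorem measurable_lintegral_mul_comp {F G : EuclideanSpace ℝ (Fin n) → ℝ≥0∞}
    (hF : Measurable F) (hG : Measurable G) :
    Measurable fun x => ∫⁻ y, F (x - y) * G (x + y) := by
  refine Measurable.lintegral_prod_right' (f := fun p : EuclideanSpace ℝ (Fin n) ×
    EuclideanSpace ℝ (Fin n) => F (p.1 - p.2) * G (p.1 + p.2)) ?_
  exact (hF.comp (measurable_fst.sub measurable_snd)).mul
    (hG.comp (measurable_fst.add measurable_snd))

theorem measurable_bilinearTruncation {F G : EuclideanSpace ℝ (Fin n) → ℝ≥0∞}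
    (hF : Measurable F) (hG : Measurable G) (k : ℤ) : Measurable (bilinearTruncation F G k) := by
  refine Measurable.lintegral_prod_right' (f := fun p : EuclideanSpace ℝ (Fin n) ×
    EuclideanSpace ℝ (Fin n) => (Metric.closedBall 0 (2 ^ k)).indicator
      (fun y => F (p.1 - y) * G (p.1 + y)) p.2) ?_
  have h := ((hF.comp (measurable_fst.sub measurable_snd)).mul
    (hG.comp (measurable_fst.add measurable_snd))).indicator
      (measurable_snd (Metric.isClosed_closedBall.measurableSet :
        MeasurableSet (Metric.closedBall (0 : EuclideanSpace ℝ (Fin n)) (2 ^ k))))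
  exact h

/-- On a lattice cube of side `2 ^ k`, the operator at scale `2 ^ k` only sees the restrictions of
the two functions to the threefold dilation of the cube. -/
theorem bilinearTruncation_le {F G : EuclideanSpace ℝ (Fin n) → ℝ≥0∞} {k : ℤ} {j : Fin n → ℤ}
    {x : EuclideanSpace ℝ (Fin n)} (hx : x ∈ dilatedCube 0 k j) :
    bilinearTruncation F G k x ≤
      ∫⁻ y, (dilatedCube 1 k j).indicator F (x - y) * (dilatedCube 1 k j).indicator G (x + y) := by
  refine lintegral_mono fun y => ?_
  by_cases hy : y ∈ Metric.closedBall 0 (2 ^ k)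
  · have hy' : ‖y‖ ≤ 2 ^ k := by simpa using hy
    have h1 := add_mem_dilatedCube hx hy'
    have h2 := add_mem_dilatedCube hx ((norm_neg y).trans_le hy')
    rw [← sub_eq_add_neg] at h2
    simp [hy', h1, h2]
  · rw [Set.indicator_of_notMem hy]
    exact zero_le

theorem lintegral_indicator_rpow {S : Set (EuclideanSpace ℝ (Fin n))} (hS : MeasurableSet S)
    (F : EuclideanSpace ℝ (Fin n) → ℝ≥0∞) {r : ℝ} (hr : 0 < r) :
    ∫⁻ y, S.indicator F y ^ r = ∫⁻ y in S, F y ^ r := by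
  rw [← lintegral_indicator hS]
  refine lintegral_congr fun y => ?_
  by_cases hy : y ∈ S <;> simp [hy, hr]

/-- The product of the averages of `F ^ r` and `G ^ s`, normalized to degree one, over a dilated
lattice cube. -/
def averageProduct (F G : EuclideanSpace ℝ (Fin n) → ℝ≥0∞) (r s a : ℝ) (k : ℤ)
    (j : Fin n → ℤ) : ℝ≥0∞ :=
  dilatedAvg a k j (fun y => F y ^ r) ^ (1 / r) * dilatedAvg a k j (fun y => G y ^ s) ^ (1 / s)

/-- The local estimate on a lattice cube: Young's inequality followed by the weight condition. -/
theorem setLIntegral_bilinearTruncation_rpow_le {F G W : EuclideanSpace ℝ (Fin n) → ℝ≥0∞}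
    (hF : Measurable F) (hG : Measurable G) (hW : AEMeasurable W) {q r s θ : ℝ} (hq : 0 < q)
    (hr : 0 < r) (hs : 0 < s) (hθ : 0 ≤ θ) (hθr : θ ≤ 1 / r) (hθs : θ ≤ 1 / s)
    (hrs : 1 / r + 1 / s = 1 + θ) (k : ℤ) (j : Fin n → ℤ)
    {E : Set (EuclideanSpace ℝ (Fin n))} {C : ℝ≥0∞}
    (hE : ∀ H : EuclideanSpace ℝ (Fin n) → ℝ≥0∞, Measurable H →
        volume (dilatedCube 0 k j) ^ (q * θ) * ∫⁻ x in dilatedCube 0 k j, H x ^ (q * θ) * W x ≤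
          C * (∫⁻ x in dilatedCube 0 k j, H x) ^ (q * θ) * ∫⁻ x in E, W x) :
    ∫⁻ x in dilatedCube 0 k j, bilinearTruncation F G k x ^ q * W x ≤
      C * (3 ^ n) ^ (q + q * θ) * (volume (dilatedCube 0 k j) ^ q * averageProduct F G r s 1 k j ^ q *
        ∫⁻ x in E, W x) := by
  set Q := dilatedCube 0 k j
  set F₁ := (dilatedCube 1 k j).indicator F with hF₁
  set G₁ := (dilatedCube 1 k j).indicator G with hG₁
  have hF₁m : Measurable F₁ := hF.indicator (measurableSet_dilatedCube _ _ _)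
  have hG₁m : Measurable G₁ := hG.indicator (measurableSet_dilatedCube _ _ _)
  set U := ∫⁻ y, F₁ y ^ r with hU
  set V := ∫⁻ y, G₁ y ^ s with hV
  set H : EuclideanSpace ℝ (Fin n) → ℝ≥0∞ := fun x => ∫⁻ y, F₁ (x - y) ^ r * G₁ (x + y) ^ s with hH
  have hHm : Measurable H :=
    measurable_lintegral_mul_comp (hF₁m.pow_const r) (hG₁m.pow_const s)
  have hHint : ∫⁻ x in Q, H x ≤ U * V := (setLIntegral_le_lintegral _ _).trans
    (lintegral_lintegral_mul_comp_le (hF₁m.pow_const r) (hG₁m.pow_const s))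
  have hqθ : 0 ≤ q * θ := by positivity
  have hqr : 0 ≤ q * (1 / r - θ) := mul_nonneg hq.le (sub_nonneg.2 hθr)
  have hqs : 0 ≤ q * (1 / s - θ) := mul_nonneg hq.le (sub_nonneg.2 hθs)
  have hQ0 : volume Q ≠ 0 := volume_dilatedCube_ne_zero le_rfl _ _
  have hQt : volume Q ≠ ∞ := volume_dilatedCube_ne_top _ _ _
  have hpoint : ∀ x ∈ Q, bilinearTruncation F G k x ^ q * W x ≤
      U ^ (q * (1 / r - θ)) * V ^ (q * (1 / s - θ)) * (H x ^ (q * θ) * W x) := by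
    intro x hx
    calc bilinearTruncation F G k x ^ q * W x
        ≤ (H x ^ θ * U ^ (1 / r - θ) * V ^ (1 / s - θ)) ^ q * W x := by
          gcongr
          exact (bilinearTruncation_le hx).trans
            (lintegral_mul_comp_le hF₁m hG₁m hr hs hθ hθr hθs hrs x)
      _ = _ := by
          rw [ENNReal.mul_rpow_of_nonneg _ _ hq.le, ENNReal.mul_rpow_of_nonneg _ _ hq.le,
            ← ENNReal.rpow_mul, ← ENNReal.rpow_mul, ← ENNReal.rpow_mul, mul_comm θ q,
            mul_comm _ q, mul_comm _ q]
          ring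
  have hbound : volume Q ^ (q * θ) * ∫⁻ x in Q, bilinearTruncation F G k x ^ q * W x ≤
      C * (U ^ (q * (1 / r)) * V ^ (q * (1 / s))) * ∫⁻ x in E, W x := by
    calc _ ≤ volume Q ^ (q * θ) * ∫⁻ x in Q,
            U ^ (q * (1 / r - θ)) * V ^ (q * (1 / s - θ)) * (H x ^ (q * θ) * W x) := by
          gcongr 1
          exact setLIntegral_mono' (measurableSet_dilatedCube _ _ _) hpoint
      _ = U ^ (q * (1 / r - θ)) * V ^ (q * (1 / s - θ)) *
            (volume Q ^ (q * θ) * ∫⁻ x in Q, H x ^ (q * θ) * W x) := by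
          have hm : AEMeasurable (fun x => H x ^ (q * θ) * W x) (volume.restrict Q) :=
            (hHm.pow_const _).aemeasurable.mul hW.restrict
          rw [lintegral_const_mul'' _ hm]
          ring
      _ ≤ U ^ (q * (1 / r - θ)) * V ^ (q * (1 / s - θ)) *
            (C * (U * V) ^ (q * θ) * ∫⁻ x in E, W x) := by
          gcongr 1
          refine (hE H hHm).trans ?_
          gcongr
      _ = _ := by
          have e1 : q * (1 / r) = q * (1 / r - θ) + q * θ := by ring
          have e2 : q * (1 / s) = q * (1 / s - θ) + q * θ := by ring
          rw [e1, e2, ENNReal.rpow_add_of_nonneg _ _ hqr hqθ, ENNReal.rpow_add_of_nonneg _ _ hqs hqθ,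
            ENNReal.mul_rpow_of_nonneg _ _ hqθ]
          ring
  have hthree : ENNReal.ofReal (1 + 2 * 1) = 3 := by norm_num
  have hUV : U ^ (q * (1 / r)) * V ^ (q * (1 / s)) =
      (3 ^ n) ^ (q + q * θ) * volume Q ^ (q + q * θ) * averageProduct F G r s 1 k j ^ q := by
    have hsum : q + q * θ = q * (1 / r) + q * (1 / s) := by rw [← mul_add, hrs]; ring
    have hT0 : volume (dilatedCube 1 k j) ≠ 0 := volume_dilatedCube_ne_zero zero_le_one _ _
    have hTt : volume (dilatedCube 1 k j) ≠ ∞ := volume_dilatedCube_ne_top _ _ _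
    rw [← ENNReal.mul_rpow_of_nonneg _ _ (by positivity), ← hthree, ← volume_dilatedCube_eq_mul,
      hsum, ENNReal.rpow_add _ _ hT0 hTt, hU, hV, hF₁, hG₁,
      lintegral_indicator_rpow (measurableSet_dilatedCube _ _ _) F hr,
      lintegral_indicator_rpow (measurableSet_dilatedCube _ _ _) G hs,
      ← dilatedAvg_mul_volume zero_le_one, ← dilatedAvg_mul_volume zero_le_one, averageProduct,
      ENNReal.mul_rpow_of_nonneg _ _ (by positivity), ENNReal.mul_rpow_of_nonneg _ _ (by positivity),
      ENNReal.mul_rpow_of_nonneg _ _ hq.le, ← ENNReal.rpow_mul, ← ENNReal.rpow_mul,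
      mul_comm (1 / r) q, mul_comm (1 / s) q]
    ring
  have hp0 : volume Q ^ (q * θ) ≠ 0 := (ENNReal.rpow_pos (pos_iff_ne_zero.2 hQ0) hQt).ne'
  have hpt : volume Q ^ (q * θ) ≠ ∞ := ENNReal.rpow_ne_top_of_nonneg hqθ hQt
  rw [← ENNReal.mul_le_mul_iff_right hp0 hpt]
  refine hbound.trans_eq ?_
  rw [hUV, ENNReal.rpow_add _ _ hQ0 hQt]
  ring

/-! ### Summation over scales -/

theorem tsum_rpow_le_tsum_rpow {ι : Type*} (a : ι → ℝ≥0∞) {q : ℝ} (hq : 0 < q) (hq1 : q ≤ 1) :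
    (∑' i, a i) ^ q ≤ ∑' i, a i ^ q := by
  have h : ∀ s : Finset ι, (∑ i ∈ s, a i) ^ q ≤ ∑ i ∈ s, a i ^ q := by
    classical
    intro s
    induction s using Finset.induction_on with
    | empty => simp [hq]
    | insert i s hi ih =>
      rw [Finset.sum_insert hi, Finset.sum_insert hi]
      exact (ENNReal.rpow_add_le_add_rpow _ _ hq.le hq1).trans (by gcongr)
  refine le_of_tendsto ((ENNReal.continuous_rpow_const.tendsto _).comp
    (ENNReal.summable (f := a)).hasSum) (Filter.Eventually.of_forall fun s => ?_)
  exact (h s).trans (ENNReal.sum_le_tsum s)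

/-- The number `2 ^ k` as an extended nonnegative real. -/
def scale (k : ℤ) : ℝ≥0∞ := ENNReal.ofReal (2 ^ k)

theorem scale_ne_zero (k : ℤ) : scale k ≠ 0 := by
  have : (0 : ℝ) < 2 ^ k := by positivity
  simp [scale, this]

theorem scale_ne_top (k : ℤ) : scale k ≠ ∞ := ENNReal.ofReal_ne_top

theorem scale_rpow (k : ℤ) (a : ℝ) : scale k ^ a = 2 ^ ((k : ℝ) * a) := by
  have : scale k = 2 ^ (k : ℝ) := by
    rw [scale, ← Real.rpow_intCast, ← ENNReal.ofReal_rpow_of_pos (by norm_num)]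
    norm_num
  rw [this, ENNReal.rpow_mul]

theorem sum_scale_rpow_le {β : ℝ} (k₀ : ℤ) {s : Finset ℤ} (hs : ∀ k ∈ s, k ≤ k₀) :
    ∑ k ∈ s, scale k ^ β ≤ (1 - 2 ^ (-β))⁻¹ * scale k₀ ^ β := by
  have hinj : Function.Injective fun k : s => (k₀ - k.1).toNat := by
    intro a b hab
    have ha := hs a.1 a.2
    have hb := hs b.1 b.2
    simp only at hab
    exact Subtype.ext (by lia)
  calc ∑ k ∈ s, scale k ^ β
      = ∑' k : s, scale k₀ ^ β * (2 ^ (-β)) ^ (k₀ - k.1).toNat := by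
        rw [← Finset.tsum_subtype]
        refine tsum_congr fun k => ?_
        have hk := hs k.1 k.2
        have hcast : (((k₀ - k.1).toNat : ℕ) : ℝ) = k₀ - k.1 := by
          have : (((k₀ - k.1).toNat : ℕ) : ℤ) = k₀ - k.1 := Int.toNat_of_nonneg (by lia)
          exact_mod_cast this
        rw [scale_rpow, scale_rpow, ← ENNReal.rpow_natCast, ← ENNReal.rpow_mul,
          ← ENNReal.rpow_add _ _ (by simp) (by simp), hcast]
        congr 1; ring
    _ ≤ ∑' i : ℕ, scale k₀ ^ β * (2 ^ (-β)) ^ i :=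
        ENNReal.tsum_comp_le_tsum_of_injective hinj fun i => scale k₀ ^ β * (2 ^ (-β)) ^ i
    _ = _ := by rw [ENNReal.tsum_mul_left, ENNReal.tsum_geometric, mul_comm]

/-- The points of the lattice cube `Q` with index `(k, j)` at which, for every lattice cube `P` of
side at most `2 ^ k` containing the point, the averages of `F ^ r` and `G ^ s` over `3P` are at most
`B` times those over `5Q`. -/
def mainPart (F G : EuclideanSpace ℝ (Fin n) → ℝ≥0∞) (r s : ℝ) (B : ℝ≥0∞) (k : ℤ)
    (j : Fin n → ℤ) : Set (EuclideanSpace ℝ (Fin n)) :=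
  dilatedCube 0 k j \
    (exceptionalSet (fun y => F y ^ r) k j (B * dilatedAvg 2 k j fun y => F y ^ r) ∪
      exceptionalSet (fun y => G y ^ s) k j (B * dilatedAvg 2 k j fun y => G y ^ s))

theorem mainPart_subset (F G : EuclideanSpace ℝ (Fin n) → ℝ≥0∞) (r s : ℝ) (B : ℝ≥0∞) (k : ℤ)
    (j : Fin n → ℤ) : mainPart F G r s B k j ⊆ dilatedCube 0 k j := Set.sdiff_subset

theorem measurableSet_mainPart (F G : EuclideanSpace ℝ (Fin n) → ℝ≥0∞) (r s : ℝ) (B : ℝ≥0∞)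
    (k : ℤ) (j : Fin n → ℤ) : MeasurableSet (mainPart F G r s B k j) :=
  (measurableSet_dilatedCube _ _ _).diff
    ((measurableSet_exceptionalSet _ _ _ _).union (measurableSet_exceptionalSet _ _ _ _))

theorem volume_diff_mainPart_le (F G : EuclideanSpace ℝ (Fin n) → ℝ≥0∞) (r s : ℝ) {B : ℝ≥0∞}
    (hB : B ≠ 0) (k : ℤ) (j : Fin n → ℤ) :
    B * volume (dilatedCube 0 k j \ mainPart F G r s B k j) ≤
      2 * 15 ^ n * volume (dilatedCube 0 k j) := by
  have hsub : dilatedCube 0 k j \ mainPart F G r s B k j ⊆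
      exceptionalSet (fun y => F y ^ r) k j (B * dilatedAvg 2 k j fun y => F y ^ r) ∪
      exceptionalSet (fun y => G y ^ s) k j (B * dilatedAvg 2 k j fun y => G y ^ s) := by
    rw [mainPart, Set.sdiff_sdiff_right_self]
    exact Set.inter_subset_right
  calc _ ≤ B * (volume (exceptionalSet (fun y => F y ^ r) k j
              (B * dilatedAvg 2 k j fun y => F y ^ r)) +
            volume (exceptionalSet (fun y => G y ^ s) k j
              (B * dilatedAvg 2 k j fun y => G y ^ s))) := by
        gcongr
        exact (measure_mono hsub).trans (measure_union_le _ _)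
    _ ≤ 15 ^ n * volume (dilatedCube 0 k j) + 15 ^ n * volume (dilatedCube 0 k j) := by
        rw [mul_add]
        exact add_le_add (volume_exceptionalSet_le _ _ _ hB) (volume_exceptionalSet_le _ _ _ hB)
    _ = _ := by ring

theorem dilatedAvg_le_of_notMem_exceptionalSet {h : EuclideanSpace ℝ (Fin n) → ℝ≥0∞}
    {i k : ℤ} (hik : i ≤ k) {j' j : Fin n → ℤ} {t : ℝ≥0∞} {x : EuclideanSpace ℝ (Fin n)}
    (hx : x ∈ dilatedCube 0 k j) (hx' : x ∈ dilatedCube 0 i j') (hxe : x ∉ exceptionalSet h k j t) :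
    dilatedAvg 1 i j' h ≤ t := by
  by_contra! hlt
  exact hxe (Set.mem_biUnion (x := (i, j')) ⟨hik, ⟨x, hx', hx⟩, hlt⟩ hx')

theorem averageProduct_le_of_mem_mainPart {F G : EuclideanSpace ℝ (Fin n) → ℝ≥0∞} {r s : ℝ}
    (hr : 0 < r) (hs : 0 < s) {B : ℝ≥0∞} {i k : ℤ} (hik : i ≤ k) {j' j : Fin n → ℤ}
    {x : EuclideanSpace ℝ (Fin n)} (hx : x ∈ mainPart F G r s B k j)
    (hx' : x ∈ dilatedCube 0 i j') :
    averageProduct F G r s 1 i j' ≤ B ^ (1 / r + 1 / s) * averageProduct F G r s 2 k j := by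
  have h1 := dilatedAvg_le_of_notMem_exceptionalSet hik hx.1 hx' fun h => hx.2 (Or.inl h)
  have h2 := dilatedAvg_le_of_notMem_exceptionalSet hik hx.1 hx' fun h => hx.2 (Or.inr h)
  calc averageProduct F G r s 1 i j'
      ≤ (B * dilatedAvg 2 k j fun y => F y ^ r) ^ (1 / r) *
          (B * dilatedAvg 2 k j fun y => G y ^ s) ^ (1 / s) := by
        unfold averageProduct; gcongr
    _ = _ := by
        rw [ENNReal.mul_rpow_of_nonneg _ _ (by positivity),
          ENNReal.mul_rpow_of_nonneg _ _ (by positivity),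
          ENNReal.rpow_add_of_nonneg _ _ (by positivity) (by positivity), averageProduct]
        ring

/-- The fivefold dilation of a lattice cube containing `x` competes in the supremum that defines the
maximal function at `x`. -/
theorem scale_rpow_mul_averageProduct_le_maximal {α r s : ℝ} (hα : 0 < α) (hn : n ≠ 0)
    (f g : EuclideanSpace ℝ (Fin n) → ℂ) {k : ℤ} {j : Fin n → ℤ} {x : EuclideanSpace ℝ (Fin n)}
    (hx : x ∈ dilatedCube 0 k j) :
    scale k ^ α * averageProduct (fun y => ‖f y‖ₑ) (fun y => ‖g y‖ₑ) r s 2 k j ≤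
      maximal α r s f g x := by
  have hscale : scale k ^ α ≤ volume (dilatedCube 2 k j) ^ (α / n) := by
    calc scale k ^ α = volume (dilatedCube 0 k j) ^ (α / n) := by
          rw [volume_latticeCube, ← ENNReal.rpow_natCast, ← ENNReal.rpow_mul, scale,
            mul_div_cancel₀ _ (by exact_mod_cast hn)]
      _ ≤ _ := by
          gcongr
          exact dilatedCube_subset zero_le_two _ _
  refine le_trans ?_ (le_iSup₂_of_le (dilatedCorner 2 k j) (dilatedSide 2 k)
    (le_iSup₂_of_le (dilatedSide_pos zero_le_two k)
      (dilatedCube_subset zero_le_two _ _ hx) le_rfl))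
  rw [averageProduct, ← mul_assoc]
  exact mul_le_mul' (mul_le_mul' hscale le_rfl) le_rfl

/-- At a fixed point `x`, the sum over those scales for which `x` lies in the main part of its
lattice cube is a geometric series, governed by the largest such scale. -/
theorem tsum_mainPart_le_maximal {α q r s : ℝ} (hα : 0 < α) (hq : 0 < q) (hr : 0 < r) (hs : 0 < s)
    (hn : n ≠ 0) (B : ℝ≥0∞) (f g : EuclideanSpace ℝ (Fin n) → ℂ) (x : EuclideanSpace ℝ (Fin n)) :
    ∑' k : ℤ, ∑' j : Fin n → ℤ,
      (mainPart (fun y => ‖f y‖ₑ) (fun y => ‖g y‖ₑ) r s B k j).indicator (fun _ =>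
        scale k ^ (α * q) * averageProduct (fun y => ‖f y‖ₑ) (fun y => ‖g y‖ₑ) r s 1 k j ^ q) x ≤
      (B ^ (1 / r + 1 / s)) ^ q * (1 - 2 ^ (-(α * q)))⁻¹ * maximal α r s f g x ^ q := by
  classical
  set F : EuclideanSpace ℝ (Fin n) → ℝ≥0∞ := fun y => ‖f y‖ₑ with hF
  set G : EuclideanSpace ℝ (Fin n) → ℝ≥0∞ := fun y => ‖g y‖ₑ with hG
  -- Only the cube of side `2 ^ k` around `x` contributes to the sum over `j`.
  have hj : ∀ k, ∑' j : Fin n → ℤ, (mainPart F G r s B k j).indicator (fun _ =>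
        scale k ^ (α * q) * averageProduct F G r s 1 k j ^ q) x =
      if x ∈ mainPart F G r s B k (latticeIndex k x) then
        scale k ^ (α * q) * averageProduct F G r s 1 k (latticeIndex k x) ^ q else 0 := by
    intro k
    rw [tsum_eq_single (latticeIndex k x), Set.indicator_apply]
    intro j hne
    refine Set.indicator_of_notMem (fun hx => hne ?_) _
    exact (mem_latticeCube_iff.1 (mainPart_subset _ _ _ _ _ _ _ hx)).symm
  simp_rw [hj]
  rw [ENNReal.tsum_eq_iSup_sum]
  refine iSup_le fun S => ?_
  rw [← Finset.sum_filter]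
  set S' := S.filter fun k => x ∈ mainPart F G r s B k (latticeIndex k x) with hS'
  rcases S'.eq_empty_or_nonempty with h0 | hne
  · simp [h0]
  obtain ⟨k₀, hk₀, hmax⟩ := S'.exists_max_image id hne
  have hx₀ : x ∈ mainPart F G r s B k₀ (latticeIndex k₀ x) := (Finset.mem_filter.1 hk₀).2
  set a₀ := averageProduct F G r s 2 k₀ (latticeIndex k₀ x) with ha₀
  calc ∑ k ∈ S', scale k ^ (α * q) * averageProduct F G r s 1 k (latticeIndex k x) ^ q
      ≤ ∑ k ∈ S', scale k ^ (α * q) * (B ^ (1 / r + 1 / s) * a₀) ^ q := by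
        refine Finset.sum_le_sum fun k hk => ?_
        gcongr
        exact averageProduct_le_of_mem_mainPart hr hs (hmax k hk) hx₀ (mem_latticeCube_iff.2 rfl)
    _ ≤ (1 - 2 ^ (-(α * q)))⁻¹ * scale k₀ ^ (α * q) * (B ^ (1 / r + 1 / s) * a₀) ^ q := by
        rw [← Finset.sum_mul]
        gcongr
        exact sum_scale_rpow_le k₀ hmax
    _ = (B ^ (1 / r + 1 / s)) ^ q * (1 - 2 ^ (-(α * q)))⁻¹ * (scale k₀ ^ α * a₀) ^ q := by
        rw [ENNReal.mul_rpow_of_nonneg _ _ hq.le, ENNReal.mul_rpow_of_nonneg _ _ hq.le,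
          ENNReal.rpow_mul]
        ring
    _ ≤ _ := by
        gcongr
        exact scale_rpow_mul_averageProduct_le_maximal hα hn f g (mem_latticeCube_iff.2 rfl)

/-! ### The estimate for the absolute integral -/

theorem enorm_BIIntegrand_le {α : ℝ} (hαn : α < n) (f g : EuclideanSpace ℝ (Fin n) → ℂ)
    (x y : EuclideanSpace ℝ (Fin n)) :
    ‖BIIntegrand α f g x y‖ₑ ≤ ∑' k : ℤ, 2 ^ ((n : ℝ) - α) * scale k ^ (α - n) *
      (Metric.closedBall 0 (2 ^ k)).indicator (fun y => ‖f (x - y)‖ₑ * ‖g (x + y)‖ₑ) y := by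
  rcases eq_or_ne y 0 with rfl | hy
  · -- division by zero makes the integrand vanish at the singularity
    have : (n : ℝ) - α ≠ 0 := by linarith
    simp [BIIntegrand, Real.zero_rpow this]
  have hy0 : 0 < ‖y‖ := norm_pos_iff.2 hy
  obtain ⟨k, hk⟩ := exists_mem_Ioc_zpow hy0 (one_lt_two : (1 : ℝ) < 2)
  -- The term of index `k + 1` alone suffices, as `2 ^ k < ‖y‖ ≤ 2 ^ (k + 1)`.
  refine le_trans ?_ (ENNReal.le_tsum (k + 1))
  rw [Set.indicator_of_mem (by simpa using hk.2), BIIntegrand, div_eq_mul_inv, enorm_mul, enorm_mul,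
    mul_comm]
  gcongr
  have hd : 0 < (n : ℝ) - α := sub_pos.2 hαn
  have h1 : ‖(((‖y‖ ^ ((n : ℝ) - α) : ℝ) : ℂ))⁻¹‖ₑ = ENNReal.ofReal ((‖y‖ ^ ((n : ℝ) - α))⁻¹) := by
    rw [← ofReal_norm, norm_inv, Complex.norm_real,
      Real.norm_of_nonneg (by positivity)]
  rw [h1, scale_rpow, ← ENNReal.rpow_add _ _ (by simp) (by simp)]
  calc ENNReal.ofReal ((‖y‖ ^ ((n : ℝ) - α))⁻¹)
      ≤ ENNReal.ofReal ((((2 : ℝ) ^ k) ^ ((n : ℝ) - α))⁻¹) := by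
        gcongr
        exact hk.1.le
    _ = ENNReal.ofReal ((2 : ℝ) ^ ((n : ℝ) - α + ((k + 1 : ℤ) : ℝ) * (α - n))) := by
        rw [← Real.rpow_intCast, ← Real.rpow_mul (by norm_num), ← Real.rpow_neg (by norm_num)]
        congr 2; push_cast; ring
    _ = _ := by
        rw [← ENNReal.ofReal_rpow_of_pos (by norm_num)]; norm_num

/-- The estimate for measurable functions, with the operator replaced by the integral of the
absolute value of its integrand. -/
theorem lintegral_lintegral_enorm_rpow_le {α q r s θ : ℝ} (hα : 0 < α) (hαn : α < n) (hq : 0 < q)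
    (hq1 : q ≤ 1) (hr : 0 < r) (hs : 0 < s) (hθ : 0 ≤ θ) (hθr : θ ≤ 1 / r) (hθs : θ ≤ 1 / s)
    (hrs : 1 / r + 1 / s = 1 + θ) {W : EuclideanSpace ℝ (Fin n) → ℝ≥0∞} (hWm : AEMeasurable W)
    (hW : ReverseHolderOnLargeSubsets (q * θ) W) :
    ∃ C : ℝ≥0, ∀ f g : EuclideanSpace ℝ (Fin n) → ℂ, Measurable f → Measurable g →
      ∫⁻ x, (∫⁻ y, ‖BIIntegrand α f g x y‖ₑ) ^ q * W x ≤
        C * ∫⁻ x, maximal α r s f g x ^ q * W x := by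
  have hn : n ≠ 0 := by
    rintro rfl
    simp only [Nat.cast_zero] at hαn
    linarith
  obtain ⟨ε, hε, C, hC⟩ := hW
  -- With this `B`, the main part of a cube misses at most the proportion `ε` of it.
  set B : ℝ≥0 := 2 * 15 ^ n / ε with hB
  have hB0 : (B : ℝ≥0∞) ≠ 0 := by simp [hB, hε.ne']
  set D : ℝ≥0∞ := (2 ^ ((n : ℝ) - α)) ^ q * (C * (3 ^ n) ^ (q + q * θ)) with hD
  set D' : ℝ≥0∞ := ((B : ℝ≥0∞) ^ (1 / r + 1 / s)) ^ q * (1 - 2 ^ (-(α * q)))⁻¹ with hD'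
  have hDt : D ≠ ∞ := by
    refine ENNReal.mul_ne_top (ENNReal.rpow_ne_top_of_nonneg hq.le
      (ENNReal.rpow_ne_top_of_nonneg (by linarith) (by simp)))
      (ENNReal.mul_ne_top ENNReal.coe_ne_top (ENNReal.rpow_ne_top_of_nonneg (by positivity)
        (by simp)))
  have hDt' : D' ≠ ∞ := by
    refine ENNReal.mul_ne_top (ENNReal.rpow_ne_top_of_nonneg hq.le
      (ENNReal.rpow_ne_top_of_nonneg (by positivity) ENNReal.coe_ne_top)) ?_
    rw [ENNReal.inv_ne_top]
    refine (tsub_pos_of_lt (ENNReal.rpow_lt_one_of_one_lt_of_neg (by norm_num) ?_)).ne'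
    have : 0 < α * q := by positivity
    linarith
  refine ⟨(D * D').toNNReal, fun f g hf hg => ?_⟩
  rw [ENNReal.coe_toNNReal (ENNReal.mul_ne_top hDt hDt')]
  set F : EuclideanSpace ℝ (Fin n) → ℝ≥0∞ := fun y => ‖f y‖ₑ with hFdef
  set G : EuclideanSpace ℝ (Fin n) → ℝ≥0∞ := fun y => ‖g y‖ₑ with hGdef
  have hF : Measurable F := hf.enorm
  have hG : Measurable G := hg.enorm
  set c : ℤ → ℝ≥0∞ := fun k => 2 ^ ((n : ℝ) - α) * scale k ^ (α - n) with hc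
  set T : ℤ → EuclideanSpace ℝ (Fin n) → ℝ≥0∞ := fun k => bilinearTruncation F G k with hT
  have hTm : ∀ k, Measurable (T k) := fun k => measurable_bilinearTruncation hF hG k
  have hsum : ∀ x, ∫⁻ y, ‖BIIntegrand α f g x y‖ₑ ≤ ∑' k, c k * T k x := by
    intro x
    have hm : ∀ k : ℤ, Measurable fun y => (Metric.closedBall 0 (2 ^ k)).indicator
        (fun y => F (x - y) * G (x + y)) y := fun k =>
      ((hF.comp (measurable_const.sub measurable_id)).mul
        (hG.comp (measurable_const.add measurable_id))).indicator
          Metric.isClosed_closedBall.measurableSet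
    refine (lintegral_mono fun y => enorm_BIIntegrand_le hαn f g x y).trans_eq ?_
    rw [lintegral_tsum fun k => ((hm k).const_mul _).aemeasurable]
    exact tsum_congr fun k => lintegral_const_mul _ (hm k)
  have hlocal : ∀ (k : ℤ) (j : Fin n → ℤ),
      c k ^ q * ∫⁻ x in dilatedCube 0 k j, T k x ^ q * W x ≤
        D * ∫⁻ x, (mainPart F G r s B k j).indicator (fun _ =>
          scale k ^ (α * q) * averageProduct F G r s 1 k j ^ q) x * W x := by
    intro k j
    set E := mainPart F G r s B k j with hE
    have hEm : MeasurableSet E := measurableSet_mainPart _ _ _ _ _ _ _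
    have hvol : volume (dilatedCube 0 k j \ E) ≤ ε * volume (dilatedCube 0 k j) := by
      have h1 := volume_diff_mainPart_le F G r s hB0 k j
      have h2 : (2 * 15 ^ n : ℝ≥0∞) = B * ε := by
        rw [← ENNReal.coe_mul, hB, div_mul_cancel₀ _ hε.ne']
        push_cast; rfl
      rw [h2, mul_assoc] at h1
      exact (ENNReal.mul_le_mul_iff_right hB0 ENNReal.coe_ne_top).1 h1
    have hloc := setLIntegral_bilinearTruncation_rpow_le hF hG hWm hq hr hs hθ hθr hθs hrs k j
      (E := E) (C := C) (hC _ _ (dilatedSide_pos le_rfl k) E (mainPart_subset _ _ _ _ _ _ _) hEm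
        hvol)
    have hright : ∫⁻ x, E.indicator (fun _ =>
          scale k ^ (α * q) * averageProduct F G r s 1 k j ^ q) x * W x =
        scale k ^ (α * q) * averageProduct F G r s 1 k j ^ q * ∫⁻ x in E, W x := by
      rw [← lintegral_const_mul'' _ hWm.restrict, ← lintegral_indicator hEm]
      refine lintegral_congr fun x => ?_
      by_cases hx : x ∈ E <;> simp [hx]
    have hpow : c k ^ q * volume (dilatedCube 0 k j) ^ q =
        (2 ^ ((n : ℝ) - α)) ^ q * scale k ^ (α * q) := by
      rw [hc, volume_latticeCube, ← scale, ENNReal.mul_rpow_of_nonneg _ _ hq.le,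
        ← ENNReal.rpow_natCast, mul_assoc, ← ENNReal.mul_rpow_of_nonneg _ _ hq.le,
        ← ENNReal.rpow_add _ _ (scale_ne_zero k) (scale_ne_top k), sub_add_cancel,
        ← ENNReal.rpow_mul (scale k)]
    rw [hright]
    calc _ ≤ c k ^ q * (C * (3 ^ n) ^ (q + q * θ) * (volume (dilatedCube 0 k j) ^ q *
            averageProduct F G r s 1 k j ^ q * ∫⁻ x in E, W x)) := by gcongr
      _ = c k ^ q * volume (dilatedCube 0 k j) ^ q * (C * (3 ^ n) ^ (q + q * θ)) *
            (averageProduct F G r s 1 k j ^ q * ∫⁻ x in E, W x) := by ring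
      _ = _ := by rw [hpow, hD]; ring
  have hind : ∀ k j, AEMeasurable (fun x => (mainPart F G r s B k j).indicator (fun _ =>
      scale k ^ (α * q) * averageProduct F G r s 1 k j ^ q) x * W x) := fun k j =>
    (measurable_const.indicator (measurableSet_mainPart _ _ _ _ _ _ _)).aemeasurable.mul hWm
  calc ∫⁻ x, (∫⁻ y, ‖BIIntegrand α f g x y‖ₑ) ^ q * W x
      ≤ ∫⁻ x, ∑' k, c k ^ q * (T k x ^ q * W x) := by
        refine lintegral_mono fun x => ?_
        calc _ ≤ (∑' k, c k * T k x) ^ q * W x := by gcongr; exact hsum x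
          _ ≤ (∑' k, (c k * T k x) ^ q) * W x := by
              gcongr; exact tsum_rpow_le_tsum_rpow _ hq hq1
          _ = _ := by
              rw [← ENNReal.tsum_mul_right]
              refine tsum_congr fun k => ?_
              rw [ENNReal.mul_rpow_of_nonneg _ _ hq.le, mul_assoc]
    _ = ∑' k, ∑' j : Fin n → ℤ, c k ^ q * ∫⁻ x in dilatedCube 0 k j, T k x ^ q * W x := by
        have hm : ∀ k, AEMeasurable (fun x => T k x ^ q * W x) := fun k =>
          ((hTm k).pow_const q).aemeasurable.mul hWm
        rw [lintegral_tsum fun k => (hm k).const_mul _]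
        refine tsum_congr fun k => ?_
        rw [lintegral_const_mul'' _ (hm k), ENNReal.tsum_mul_left,
          ← lintegral_eq_tsum_latticeCube]
    _ ≤ ∑' k, ∑' j : Fin n → ℤ, D * ∫⁻ x, (mainPart F G r s B k j).indicator (fun _ =>
          scale k ^ (α * q) * averageProduct F G r s 1 k j ^ q) x * W x :=
        ENNReal.tsum_le_tsum fun k => ENNReal.tsum_le_tsum fun j => hlocal k j
    _ = D * ∫⁻ x, (∑' k, ∑' j : Fin n → ℤ, (mainPart F G r s B k j).indicator (fun _ =>
          scale k ^ (α * q) * averageProduct F G r s 1 k j ^ q) x) * W x := by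
        simp_rw [ENNReal.tsum_mul_left, ← ENNReal.tsum_mul_right]
        rw [lintegral_tsum fun k => AEMeasurable.tsum fun j => hind k j]
        congr 1
        exact tsum_congr fun k => (lintegral_tsum fun j => hind k j).symm
    _ ≤ D * ∫⁻ x, D' * maximal α r s f g x ^ q * W x := by
        gcongr with x
        exact tsum_mainPart_le_maximal hα hq hr hs hn B f g x
    _ = _ := by
        simp_rw [mul_assoc]
        rw [lintegral_const_mul' _ _ hDt']

/-! ### Passing to almost everywhere measurable functions -/

theorem maximal_congr_ae {α r s : ℝ} {f f' g g' : EuclideanSpace ℝ (Fin n) → ℂ}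
    (hf : f =ᵐ[volume] f') (hg : g =ᵐ[volume] g') :
    maximal α r s f g = maximal α r s f' g' := by
  have havg : ∀ {h h' : EuclideanSpace ℝ (Fin n) → ℂ}, h =ᵐ[volume] h' → ∀ (c) (l) (p : ℝ),
      avg c l (fun y => ‖h y‖ₑ ^ p) = avg c l fun y => ‖h' y‖ₑ ^ p := by
    intro h h' hh c l p
    unfold avg
    congr 1
    refine lintegral_congr_ae (ae_restrict_of_ae ?_)
    filter_upwards [hh] with y hy
    rw [hy]
  funext x
  simp only [maximal, havg hf, havg hg]

theorem BIIntegrand_congr_ae {α : ℝ} {f f' g g' : EuclideanSpace ℝ (Fin n) → ℂ}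
    (hf : f =ᵐ[volume] f') (hg : g =ᵐ[volume] g') (x : EuclideanSpace ℝ (Fin n)) :
    BIIntegrand α f g x =ᵐ[volume] BIIntegrand α f' g' x := by
  filter_upwards
    [(Measure.measurePreserving_sub_left volume x).quasiMeasurePreserving.ae_eq_comp hf,
      (measurePreserving_add_left volume x).quasiMeasurePreserving.ae_eq_comp hg] with y h1 h2
  simp only [Function.comp_apply] at h1 h2
  rw [BIIntegrand, BIIntegrand, h1, h2]

theorem measurable_BIIntegrand {α : ℝ} {f g : EuclideanSpace ℝ (Fin n) → ℂ}
    (hf : Measurable f) (hg : Measurable g) (x : EuclideanSpace ℝ (Fin n)) :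
    Measurable (BIIntegrand α f g x) :=
  ((hf.comp (measurable_const.sub measurable_id)).mul
    (hg.comp (measurable_const.add measurable_id))).div
      (Complex.measurable_ofReal.comp (measurable_norm.pow_const _))

end BilinearFractional

end

theorem theorem6p3 (n : ℕ) (α : ℝ) (hα : 0 < α) (hαn : α < n)
    (q : ℝ) (hq : 0 < q) (hq1 : q ≤ 1)
    (r s : ℝ) (hr : 1 ≤ r) (hs : 1 ≤ s)
    (m : ℝ≥0∞) (hm : 1 ≤ m)
    (hrsm : 1 / r + 1 / s = 1 + 1 / q * (m⁻¹).toReal)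
    (w : EuclideanSpace ℝ (Fin n) → ℝ) (hw : BilinearFractional.IsWeight w)
    (hwA : BilinearFractional.PowMemAInfty (ENNReal.conjExponent m) w) :
    ∃ C : ℝ≥0, ∀ f g : EuclideanSpace ℝ (Fin n) → ℂ,
      AEStronglyMeasurable f volume → AEStronglyMeasurable g volume →
        -- the integral that defines the operator converges absolutely whenever this is relevant
        ((∫⁻ x, BilinearFractional.maximal α r s f g x ^ q * ENNReal.ofReal (w x)) < ∞ →
          ∀ᵐ x ∂(volume.withDensity fun x => ENNReal.ofReal (w x)),
            Integrable (BilinearFractional.BIIntegrand α f g x)) ∧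
        (∫⁻ x, ‖BilinearFractional.BI α f g x‖ₑ ^ q * ENNReal.ofReal (w x)) ≤
          C * ∫⁻ x, BilinearFractional.maximal α r s f g x ^ q * ENNReal.ofReal (w x) := by
  have hr0 : 0 < r := by linarith
  have hs0 : 0 < s := by linarith
  have hr1 : 1 / r ≤ 1 := (div_le_one hr0).2 hr
  have hs1 : 1 / s ≤ 1 := (div_le_one hs0).2 hs
  have hθ : 0 ≤ 1 / q * (m⁻¹).toReal := by positivity
  have hμ : q * (1 / q * (m⁻¹).toReal) = (m⁻¹).toReal := by field_simp
  have hwm : AEMeasurable fun x => ENNReal.ofReal (w x) := hw.aemeasurable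
  obtain ⟨C, hC⟩ := BilinearFractional.lintegral_lintegral_enorm_rpow_le hα hαn hq hq1 hr0 hs0 hθ
    (by linarith) (by linarith) hrsm hwm
    (hμ.symm ▸ hwA.reverseHolderOnLargeSubsets hw hm)
  -- Both sides only depend on the almost everywhere classes of `f` and `g`.
  refine ⟨C, fun f g hf hg => ?_⟩
  have hf' := hf.ae_eq_mk
  have hg' := hg.ae_eq_mk
  have hfm := hf.stronglyMeasurable_mk.measurable
  have hgm := hg.stronglyMeasurable_mk.measurable
  have hmain : ∫⁻ x, (∫⁻ y, ‖BilinearFractional.BIIntegrand α f g x y‖ₑ) ^ q *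
      ENNReal.ofReal (w x) ≤
        C * ∫⁻ x, BilinearFractional.maximal α r s f g x ^ q * ENNReal.ofReal (w x) := by
    rw [BilinearFractional.maximal_congr_ae hf' hg']
    refine le_of_eq_of_le (lintegral_congr fun x => ?_) (hC _ _ hfm hgm)
    congr 2
    exact lintegral_congr_ae
      ((BilinearFractional.BIIntegrand_congr_ae hf' hg' x).fun_comp fun z => ‖z‖ₑ)
  refine ⟨fun hfin => ?_, le_trans (lintegral_mono fun x => ?_) hmain⟩
  · set N : EuclideanSpace ℝ (Fin n) → ℝ≥0∞ :=
      fun x => ∫⁻ y, ‖BilinearFractional.BIIntegrand α f g x y‖ₑ with hN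
    have hNm : Measurable N := by
      have hN' : N = fun x => ∫⁻ y, ‖BilinearFractional.BIIntegrand α (hf.mk f) (hg.mk g) x y‖ₑ :=
        funext fun x => lintegral_congr_ae
          ((BilinearFractional.BIIntegrand_congr_ae hf' hg' x).fun_comp fun z => ‖z‖ₑ)
      rw [hN']
      refine Measurable.lintegral_prod_right' (f := fun p : EuclideanSpace ℝ (Fin n) ×
        EuclideanSpace ℝ (Fin n) =>
          ‖BilinearFractional.BIIntegrand α (hf.mk f) (hg.mk g) p.1 p.2‖ₑ) ?_
      exact (((hfm.comp (measurable_fst.sub measurable_snd)).mul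
        (hgm.comp (measurable_fst.add measurable_snd))).div
          (Complex.measurable_ofReal.comp (measurable_snd.norm.pow_const _))).enorm
    rw [ae_withDensity_iff' hwm]
    have hlt := ae_lt_top' ((hNm.pow_const q).aemeasurable.mul hwm)
      (hmain.trans_lt (ENNReal.mul_lt_top ENNReal.coe_lt_top hfin)).ne
    filter_upwards [hlt] with x hx hwx
    refine ⟨(BilinearFractional.measurable_BIIntegrand hfm hgm x).aestronglyMeasurable.congr
      (BilinearFractional.BIIntegrand_congr_ae hf' hg' x).symm, ?_⟩
    rw [hasFiniteIntegral_iff_enorm, lt_top_iff_ne_top]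
    intro htop
    have hNx : N x = ∞ := htop
    simp [hNx, ENNReal.top_rpow_of_pos hq, ENNReal.top_mul hwx] at hx
  · gcongr
    exact enorm_integral_le_lintegral_enorm _
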